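/- **Theorem.** All matroids have a finite ground set and are loopless. For a matroid $\mathsf M$ with rank function $\mathrm{rk}$, let $\mathcal L(\mathsf M)$ be its lattice of flats ordered by inclusion, with join $\vee$. For a set $\mathcal G$ of nonempty flats and a flat $F$, let $f(\mathcal G_{\le F})$ be the set of inclusion-maximal elements of $\{G\in\mathcal G: G\subseteq F\}$. The set $\mathcal G$ is a *building set* on $\mathsf M$ if for every flat $F$ the map $$\prod_{G\in f(\mathcal G_{\le F})}[\varnothing,G]\to[\varnothing,F],\qquad (F_G)_G\mapsto\bigvee_G F_G,$$ is an isomorphism of lattices and $\mathrm{rk}(F)=\sum_{G\in f(\mathcal G_{\le F})}\mathrm{rk}(G)$. The *minimal building set* $\mathcal G_{\min}$ is the set of nonempty flats $F$ such that the restriction $\mathsf M|_F$ is connected, i.e. $\mathcal L(\mathsf M|_F)$ is not isomorphic to a Cartesian product of two lattices each having at least two elements. For a building set $\mathcal G$ the *Chow ring* is the graded ring $D(\mathsf M,\mathcal G)=\mathbb Q[x_G: G\in\mathcal G]/I$, where each $x_G$ has degree $1$ and $I$ is generated by the polynomials $$\Bigl(\prod_{H\in S}x_H\Bigr)\Bigl(\sum_{H\in\mathcal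 G,\ H\supseteq G}x_H\Bigr)^{\mathrm{rk}(G)-\mathrm{rk}(\sup(S,G))},\qquad \sup(S,G)=\bigvee_{G'\in S,\ G'\subsetneq G}G',$$ for all $S\subseteq\mathcal G$ and $G\in\mathcal G$. The *Chow polynomial* is its Hilbert series $\mathrm H^{\mathcal G}_{\mathsf M}(x)=\sum_{i\ge0}\dim_{\mathbb Q}D^i(\mathsf M,\mathcal G)\,x^i$. Its coefficients $(a_i)_{i\ge0}$ are *log-concave* if $a_i a_{i+2}\le a_{i+1}^2$ for all $i\ge 0$. 1. There is a matroid $\mathsf M$ such that $\mathcal G_{\min}$ is a building set on $\mathsf M$ and the coefficients of $\mathrm H^{\mathcal G_{\min}}_{\mathsf M}(x)$ are not log-concave. 2. There is $N$ such that for every $n\ge N$ there is a building set $\mathcal G$ on the Boolean matroid $\mathsf U_{n,n}$ (the matroid on $n$ elements in which every subset is independent) for which the coefficients of $\mathrm H^{\mathcal G}_{\mathsf U_{n,n}}(x)$ are not log-concave. -/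

import Mathlib

namespace ChowPoly

open MvPolynomial

universe u

variable {α : Type u}

/-- The flats of `M`, ordered by inclusion: the lattice of flats `L(M)`. -/
abbrev Flat (M : Matroid α) : Type u := {F : Set α // M.IsFlat F}

/-- The join in `L(M)` of a set of flats: the closure of their union. -/
def join {M : Matroid α} (S : Set (Flat M)) : Flat M :=
  ⟨M.closure (⋃ F ∈ S, (F : Set α)), M.isFlat_closure _⟩

theorem isLUB_join {M : Matroid α} (S : Set (Flat M)) : IsLUB S (join S) := by
  have hE : (⋃ F ∈ S, (F : Set α)) ⊆ M.E := Set.iUnion₂_subset fun F _ => F.2.subset_ground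
  refine ⟨fun F hF => ?_, fun K hK => ?_⟩
  · exact (Set.subset_biUnion_of_mem (u := fun F : Flat M => (F : Set α)) hF).trans
      (M.subset_closure _ hE)
  · have h : (⋃ F ∈ S, (F : Set α)) ⊆ K := Set.iUnion₂_subset fun F hF => hK hF
    exact (M.closure_subset_closure h).trans K.2.closure.subset

/-- The rank function of `M`, with natural number values (only used for matroids on a finite
ground set, where all ranks are finite). -/
noncomputable def rk (M : Matroid α) (X : Set α) : ℕ := (M.eRk X).toNat

/-- The set `f(𝒢_{≤ F})` of maximal elements of `{G ∈ 𝒢 : G ⊆ F}`. -/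
def factors {M : Matroid α} (𝒢 : Set (Flat M)) (F : Flat M) : Set (Flat M) :=
  {G | Maximal (fun H => H ∈ 𝒢 ∧ H ≤ F) G}

/-- `𝒢` is a building set on `L(M)`: a set of nonempty flats such that for every flat `F`, taking
joins is an isomorphism `∏_{G ∈ f(𝒢_{≤ F})} [∅, G] → [∅, F]`, and `rk F` is the sum of the ranks of
the elements of `f(𝒢_{≤ F})`. -/
def IsBuildingSet {M : Matroid α} (𝒢 : Set (Flat M)) : Prop :=
  (∀ G ∈ 𝒢, (G : Set α).Nonempty) ∧
  ∀ F : Flat M,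
    (∃ φ : (∀ G : factors 𝒢 F, Set.Iic (G : Flat M)) ≃o Set.Iic F,
      ∀ x, (φ x : Flat M) = join (Set.range fun G => (x G : Flat M))) ∧
    rk M (F : Set α) = ∑ᶠ G : factors 𝒢 F, rk M ((G : Flat M) : Set α)

/-- `M` is connected: `L(M)` is not isomorphic to a product of two lattices with at least two
elements each. -/
def IsConnected (M : Matroid α) : Prop :=
  ¬ ∃ (L₁ L₂ : Type u) (_ : Lattice L₁) (_ : Lattice L₂),
    Nontrivial L₁ ∧ Nontrivial L₂ ∧ Nonempty (Flat M ≃o L₁ × L₂)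

/-- The minimal building set: all nonempty flats `F` such that `M|_F` is connected. -/
def minBuildingSet (M : Matroid α) : Set (Flat M) :=
  {F | (F : Set α).Nonempty ∧ IsConnected (M.restrict (F : Set α))}

/-- `sup(S, G)`: the join of the elements of `S` that are strictly below `G`. -/
def supBelow {M : Matroid α} (S : Set (Flat M)) (G : Flat M) : Flat M :=
  join {H | H ∈ S ∧ H < G}

/-- The relation `(∏_{H ∈ S} x_H) * (∑_{H ∈ 𝒢, H ≥ G} x_H) ^ (rk G - rk sup(S, G))` in
`ℚ[x_G : G ∈ 𝒢]`. -/
noncomputable def chowRelation {M : Matroid α} (𝒢 : Set (Flat M)) (S : Finset 𝒢) (G : 𝒢) :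
    MvPolynomial 𝒢 ℚ :=
  (∏ H ∈ S, X H) *
    (∑ᶠ (H : 𝒢) (_ : (G : Flat M) ≤ H), X H) ^
      (rk M ((G : Flat M) : Set α) -
        rk M (supBelow {H | ∃ h : H ∈ 𝒢, (⟨H, h⟩ : 𝒢) ∈ S} (G : Flat M) : Set α))

/-- The ideal generated by all the relations. -/
noncomputable def chowIdeal {M : Matroid α} (𝒢 : Set (Flat M)) : Ideal (MvPolynomial 𝒢 ℚ) :=
  Ideal.span {p | ∃ (S : Finset 𝒢) (G : 𝒢), p = chowRelation 𝒢 S G}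

/-- The Chow ring `D(M, 𝒢)`. -/
abbrev ChowRing {M : Matroid α} (𝒢 : Set (Flat M)) : Type u :=
  MvPolynomial 𝒢 ℚ ⧸ chowIdeal 𝒢

/-- The graded piece `D^i(M, 𝒢)`: the image of the homogeneous polynomials of degree `i`
(each variable has degree one). -/
noncomputable def chowPiece {M : Matroid α} (𝒢 : Set (Flat M)) (i : ℕ) :
    Submodule ℚ (ChowRing 𝒢) :=
  (homogeneousSubmodule 𝒢 ℚ i).map (Ideal.Quotient.mkₐ ℚ (chowIdeal 𝒢)).toLinearMap

/-- The Chow polynomial, i.e. the Hilbert series `∑_{i ≥ 0} dim_ℚ D^i(M, 𝒢) x^i`. -/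
noncomputable def chowPolynomial {M : Matroid α} (𝒢 : Set (Flat M)) : PowerSeries ℕ :=
  PowerSeries.mk fun i => Module.finrank ℚ (chowPiece 𝒢 i)

/-- The coefficients `a₀, a₁, …` satisfy `a_i a_{i+2} ≤ a_{i+1}²` for all `i ≥ 0`. -/
def HasLogConcaveCoeffs (p : PowerSeries ℕ) : Prop :=
  ∀ i : ℕ, PowerSeries.coeff i p * PowerSeries.coeff (i + 2) p ≤ PowerSeries.coeff (i + 1) p ^ 2

/-- The Boolean matroid `U_{n,n}`: every subset of the `n`-element ground set is independent. -/
def boolean (n : ℕ) : Matroid (Fin n) := Matroid.freeOn Set.univ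

end ChowPoly

/-! Log-concavity fails between degrees 1 and 3, in one configuration realised by two matroids. Let
`𝒢` consist of a flag `A < B < T` with rank jumps at least 4, 3, 3, of seven hyperplanes `C i` of
`T` not containing `A`, and of flats of rank one. The linear relations eliminate the rank-one
variables. Since `C i` joined with `A`, `B` or another `C j` is `T`, the relations for `T` make
`x_{C i}` annihilate every other remaining variable. In low degree the ring thus looks like a
polynomial ring in three variables glued along the constants to seven rings in one variable. Its
dimensions in degrees 1, 2, 3 are 3 + 7, 6 + 7, 10 + 7, and 10 * 17 = 170 exceeds 13 ^ 2 = 169. With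
k hyperplanes the inequality (3 + k)(10 + k) > (6 + k)^2 means k > 6, hence seven.

Only bounds are needed: `finrank_le_thirteen` comes from multiplying generators, while
`ten_le_finrank` and `seventeen_le_finrank` need independence. For the latter, `chainHom` keeps a
chosen set of variables, either the flag or one `C i`, and solves for the rank-one variables. It
kills each generator of the ideal or sends it to degree at least 4, thanks to the rank jumps, so
monomials of degree at most 3 in the kept variables stay independent (`card_le_finrank_chowPiece`).

For the Boolean matroid, the `C i` are complements of points of `A`. For the minimal building set, a
matroid of rank 10 is built whose connected nonempty flats are exactly such a family. Building sets
are recognised by additivity of rank (`exists_orderIso_of_rk_le`, `isBuildingSet_of_indep`),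
connectedness by hyperplanes avoiding two given points (`isConnected_of_hyperplane`). -/

namespace ChowPoly

open MvPolynomial

universe u

variable {α : Type u}

/-! ### Natural-number rank and submodularity -/

section Rank

variable {M : Matroid α} {X Y : Set α}

theorem rk_closure (M : Matroid α) (X : Set α) : rk M (M.closure X) = rk M X := by
  simp [rk]

theorem rk_empty (M : Matroid α) : rk M ∅ = 0 := by
  simp [rk]

theorem rk_indep {I : Set α} (hI : M.Indep I) : rk M I = I.ncard := by
  rw [rk, hI.eRk_eq_encard, Set.ncard]

variable [Finite α]

theorem eRk_eq_rk (M : Matroid α) (X : Set α) : M.eRk X = (rk M X : ℕ∞) :=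
  (ENat.natCast_toNat (Matroid.eRk_ne_top_iff.2 (M.isRkFinite_set X))).symm

theorem rk_mono (h : X ⊆ Y) : rk M X ≤ rk M Y := by
  have := M.eRk_mono h
  rwa [eRk_eq_rk, eRk_eq_rk, Nat.cast_le] at this

theorem rk_inter_add_rk_union_le (M : Matroid α) (X Y : Set α) :
    rk M (X ∩ Y) + rk M (X ∪ Y) ≤ rk M X + rk M Y := by
  have := M.eRk_inter_add_eRk_union_le X Y
  simp only [eRk_eq_rk] at this
  exact_mod_cast this

theorem rk_union_le (M : Matroid α) (X Y : Set α) : rk M (X ∪ Y) ≤ rk M X + rk M Y :=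
  le_trans (Nat.le_add_left _ _) (rk_inter_add_rk_union_le M X Y)

theorem ncard_le_rk {I : Set α} (hI : M.Indep I) (h : I ⊆ X) : I.ncard ≤ rk M X :=
  (rk_indep hI).symm.trans_le (rk_mono h)

theorem rk_le_ncard (M : Matroid α) (X : Set α) : rk M X ≤ X.ncard := by
  have := M.eRk_le_encard X
  rwa [eRk_eq_rk, ← (Set.toFinite X).cast_ncard_eq, Nat.cast_le] at this

theorem rk_insert_of_notMem_closure {e : α} (he : e ∈ M.E) (h : e ∉ M.closure X) :
    rk M (insert e X) = rk M X + 1 := by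
  have := M.eRk_insert_eq_add_one ⟨he, h⟩
  simp only [eRk_eq_rk] at this
  exact_mod_cast this

theorem rk_lt_of_lt {F K : Flat M} (h : F < K) : rk M (F : Set α) < rk M (K : Set α) := by
  obtain ⟨e, heK, heF⟩ := Set.exists_of_ssubset (Subtype.coe_lt_coe.2 h)
  have h1 : rk M (insert e (F : Set α)) = rk M (F : Set α) + 1 :=
    rk_insert_of_notMem_closure (K.2.subset_ground heK) (by rwa [F.2.closure])
  have h2 : rk M (insert e (F : Set α)) ≤ rk M (K : Set α) :=
    rk_mono (Set.insert_subset heK (Subtype.coe_le_coe.2 h.le))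
  omega

theorem eq_of_le_of_rk_le {F K : Flat M} (h : F ≤ K)
    (hr : rk M (K : Set α) ≤ rk M (F : Set α)) : F = K :=
  h.eq_or_lt.resolve_right fun h' => absurd (rk_lt_of_lt h') (not_lt.2 hr)

theorem rk_iUnion_le {ι : Type*} (s : Finset ι) (X : ι → Set α) :
    rk M (⋃ i ∈ s, X i) ≤ ∑ i ∈ s, rk M (X i) := by
  classical
  induction s using Finset.induction_on with
  | empty => simp [rk_empty]
  | insert a s ha ih =>
    rw [Finset.set_biUnion_insert, Finset.sum_insert ha]
    exact (rk_union_le M _ _).trans (by omega)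

/-- Submodularity, adding one `G a` at a time: its intersection with what is already there contains
`X a`, so the rank grows by at most `rk (G a) - rk (X a)`. -/
theorem rk_union_iUnion_le {ι : Type*} (s : Finset ι) (X G : ι → Set α) (U : Set α)
    (hU : ∀ i, X i ⊆ U) (hX : ∀ i, X i ⊆ G i) :
    rk M (U ∪ ⋃ i ∈ s, G i) + ∑ i ∈ s, rk M (X i) ≤ rk M U + ∑ i ∈ s, rk M (G i) := by
  classical
  induction s using Finset.induction_on with
  | empty => simp
  | insert a s ha ih =>
    rw [Finset.set_biUnion_insert, Finset.sum_insert ha, Finset.sum_insert ha,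
      Set.union_left_comm]
    have h1 := rk_inter_add_rk_union_le M (G a) (U ∪ ⋃ i ∈ s, G i)
    have h2 : rk M (X a) ≤ rk M (G a ∩ (U ∪ ⋃ i ∈ s, G i)) :=
      rk_mono (Set.subset_inter (hX a) ((hU a).trans Set.subset_union_left))
    omega

end Rank

/-! ### The lattice of flats -/

section FlatLattice

variable {M : Matroid α}

theorem isFlat_inter {F K : Set α} (hF : M.IsFlat F) (hK : M.IsFlat K) : M.IsFlat (F ∩ K) := by
  rw [Set.inter_eq_iInter]
  exact Matroid.IsFlat.iInter fun b => by cases b <;> assumption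

instance : Lattice (Flat M) where
  inf F K := ⟨(F : Set α) ∩ K, isFlat_inter F.2 K.2⟩
  inf_le_left _ _ := Set.inter_subset_left
  inf_le_right _ _ := Set.inter_subset_right
  le_inf _ _ _ h1 h2 := Set.subset_inter h1 h2
  sup F K := join {F, K}
  le_sup_left F K := (isLUB_join {F, K}).1 (by simp)
  le_sup_right F K := (isLUB_join {F, K}).1 (by simp)
  sup_le F K N h1 h2 := (isLUB_join {F, K}).2 (by simp [h1, h2])

end FlatLattice

/-! ### Product decompositions and a criterion for building sets -/

section BuildingSet

variable {M : Matroid α}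

theorem factors_eq_singleton {𝒢 : Set (Flat M)} {F : Flat M} (hF : F ∈ 𝒢) : factors 𝒢 F = {F} := by
  ext G
  refine ⟨fun h => le_antisymm h.1.2 (h.2 ⟨hF, le_rfl⟩ h.1.2), ?_⟩
  rintro rfl
  exact ⟨⟨hF, le_rfl⟩, fun H hH _ => hH.2⟩

variable [Finite α]

/-- Additivity of rank on the cover `G` passes to subsets: any defect in the rank of the union of
the `X i` would, by `rk_union_iUnion_le`, persist in the union of the `G i`, which contains `F`. -/
theorem rk_join_range {ι : Type*} [Fintype ι] {F : Flat M} {G : ι → Flat M}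
    (hcov : ∀ e ∈ (F : Set α), ∃ i, e ∈ (G i : Set α))
    (hrk : ∑ i, rk M (G i : Set α) ≤ rk M (F : Set α)) (X : ι → Set α)
    (hX : ∀ i, X i ⊆ G i) : rk M (⋃ i, X i) = ∑ i, rk M (X i) := by
  have h1 := rk_iUnion_le (M := M) Finset.univ X
  have h2 := rk_union_iUnion_le (M := M) Finset.univ X (fun i => (G i : Set α)) (⋃ i, X i)
    (fun i => Set.subset_iUnion _ i) hX
  have h3 : rk M (F : Set α) ≤ rk M ((⋃ i, X i) ∪ ⋃ i ∈ Finset.univ, (G i : Set α)) :=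
    rk_mono fun e he => Or.inr (by simpa using hcov e he)
  simp only [Finset.mem_univ, Set.iUnion_true] at *
  omega

/-- This is injectivity of the join map. An extra element `e` of the intersection could be added to
`x i`, raising the sum of the ranks by one without raising the rank of the union, against
`rk_join_range`. -/
theorem join_range_inf {ι : Type*} [Fintype ι] {F : Flat M} {G : ι → Flat M}
    (hcov : ∀ e ∈ (F : Set α), ∃ i, e ∈ (G i : Set α))
    (hrk : ∑ i, rk M (G i : Set α) ≤ rk M (F : Set α)) (x : ι → Flat M)
    (hx : ∀ i, x i ≤ G i) (i : ι) : join (Set.range x) ⊓ G i = x i := by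
  classical
  refine le_antisymm ?_ (le_inf ((isLUB_join _).1 ⟨i, rfl⟩) (hx i))
  rintro e ⟨he, hei⟩
  by_contra hex
  have hE := (G i).2.subset_ground hei
  simp only [join, Set.biUnion_range] at he
  let y : ι → Set α := Function.update (fun j => (x j : Set α)) i (insert e (x i))
  have hy : ∀ j, y j ⊆ G j := by
    intro j
    by_cases hj : j = i
    · subst hj
      simpa [y] using Set.insert_subset hei (hx j)
    · simpa [y, Function.update_of_ne hj] using hx j
  have h1 := rk_join_range hcov hrk (fun j => (x j : Set α)) hx
  have h2 := rk_join_range hcov hrk y hy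
  have h3 : rk M (⋃ j, y j) ≤ rk M (⋃ j, (x j : Set α)) := by
    rw [← rk_closure M (⋃ j, (x j : Set α))]
    refine rk_mono (Set.iUnion_subset fun j => ?_)
    have hj : (x j : Set α) ⊆ M.closure (⋃ j, (x j : Set α)) :=
      (Set.subset_iUnion (fun j => (x j : Set α)) j).trans
        (M.subset_closure _ (Set.iUnion_subset fun j => (x j).2.subset_ground))
    by_cases h : j = i
    · subst h
      simpa [y] using Set.insert_subset he hj
    · simpa [y, Function.update_of_ne h] using hj
  have h4 : ∑ j, rk M (x j : Set α) < ∑ j, rk M (y j) := by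
    refine Finset.sum_lt_sum (fun j _ => ?_) ⟨i, Finset.mem_univ _, ?_⟩
    · by_cases h : j = i
      · subst h
        simpa [y] using rk_mono (Set.subset_insert _ _)
      · simp [y, Function.update_of_ne h]
    · have := rk_insert_of_notMem_closure (M := M) (X := (x i : Set α)) hE
        (by rwa [(x i).2.closure])
      simp [y, this]
  omega

/-- If a flat is covered by flats whose ranks add up to at most its rank, then joins of subflats
identify the interval below the flat with the product of the intervals below the cover. -/
theorem exists_orderIso_of_rk_le {ι : Type*} [Finite ι] {F : Flat M} {G : ι → Flat M}
    (hle : ∀ i, G i ≤ F) (hcov : ∀ e ∈ (F : Set α), ∃ i, e ∈ (G i : Set α))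
    (hrk : ∑ᶠ i, rk M (G i : Set α) ≤ rk M (F : Set α)) :
    ∃ φ : (∀ i, Set.Iic (G i)) ≃o Set.Iic F,
      ∀ x, (φ x : Flat M) = join (Set.range fun i => (x i : Flat M)) := by
  have := Fintype.ofFinite ι
  rw [finsum_eq_sum_of_fintype] at hrk
  have hinv : ∀ K : Set.Iic F, join (Set.range fun i => (K : Flat M) ⊓ G i) = K := by
    intro K
    refine le_antisymm ((isLUB_join _).2 ?_) ?_
    · rintro _ ⟨i, rfl⟩
      exact inf_le_left
    · intro e he
      obtain ⟨i, hi⟩ := hcov e (K.2 he)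
      exact (isLUB_join (Set.range fun i => (K : Flat M) ⊓ G i)).1 ⟨i, rfl⟩ ⟨he, hi⟩
  let φ : (∀ i, Set.Iic (G i)) ≃ Set.Iic F :=
    { toFun x := ⟨join (Set.range fun i => (x i : Flat M)), (isLUB_join _).2 (by
        rintro _ ⟨i, rfl⟩
        exact (x i).2.trans (hle i))⟩
      invFun K i := ⟨K ⊓ G i, Set.mem_Iic.2 inf_le_right⟩
      left_inv x := by
        funext i
        exact Subtype.ext (join_range_inf hcov hrk _ (fun i => (x i).2) i)
      right_inv K := Subtype.ext (hinv K) }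
  refine ⟨⟨φ, ?_⟩, fun x => rfl⟩
  intro x y
  constructor
  · intro h i
    have h1 := join_range_inf hcov hrk (fun i => (x i : Flat M)) (fun i => (x i).2) i
    have h2 := join_range_inf hcov hrk (fun i => (y i : Flat M)) (fun i => (y i).2) i
    have h3 : (φ x : Flat M) ⊓ G i ≤ (φ y : Flat M) ⊓ G i := inf_le_inf_right _ h
    change (x i : Flat M) ≤ y i
    rw [← h1, ← h2]
    exact h3
  · intro h
    refine (isLUB_join _).2 ?_
    rintro _ ⟨i, rfl⟩
    exact le_trans (h i) ((isLUB_join (Set.range fun i => (y i : Flat M))).1 ⟨i, rfl⟩)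

theorem exists_factor_ge {𝒢 : Set (Flat M)} {F G : Flat M} (hG : G ∈ 𝒢) (hF : G ≤ F) :
    ∃ H ∈ factors 𝒢 F, G ≤ H := by
  obtain ⟨H, hGH, hH⟩ := (Set.toFinite {H | H ∈ 𝒢 ∧ H ≤ F}).exists_le_maximal
    (a := G) ⟨hG, hF⟩
  exact ⟨H, hH, hGH⟩

/-- A criterion for building sets: every flat outside `𝒢` is covered by members of `𝒢`, the factors
are disjoint, and there is an independent set spanning each of the factors. -/
theorem isBuildingSet_of_indep {𝒢 : Set (Flat M)} (hne : ∀ G ∈ 𝒢, (G : Set α).Nonempty)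
    (hcov : ∀ F : Flat M, ∀ e ∈ (F : Set α), ∃ G ∈ 𝒢, G ≤ F ∧ e ∈ (G : Set α))
    (h : ∀ F : Flat M, F ∉ 𝒢 →
      (factors 𝒢 F).PairwiseDisjoint (fun G => (G : Set α)) ∧
      ∃ I, M.Indep I ∧ I ⊆ F ∧ ∀ G ∈ factors 𝒢 F, (G : Set α) ⊆ M.closure (I ∩ G)) :
    IsBuildingSet 𝒢 := by
  classical
  refine ⟨hne, fun F => ?_⟩
  have hc : ∀ e ∈ (F : Set α), ∃ i : factors 𝒢 F, e ∈ ((i : Flat M) : Set α) := by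
    intro e he
    obtain ⟨G, hG, hGF, heG⟩ := hcov F e he
    obtain ⟨H, hH, hGH⟩ := exists_factor_ge hG hGF
    exact ⟨⟨H, hH⟩, hGH heG⟩
  have hl : ∀ i : factors 𝒢 F, (i : Flat M) ≤ F := fun i => i.2.1.2
  have hr : ∑ᶠ i : factors 𝒢 F, rk M ((i : Flat M) : Set α) ≤ rk M (F : Set α) := by
    by_cases hF : F ∈ 𝒢
    · rw [finsum_set_coe_eq_finsum_mem (f := fun G : Flat M => rk M (G : Set α)),
        factors_eq_singleton hF, finsum_mem_singleton]
    · obtain ⟨hd, I, hI, hIF, hG⟩ := h F hF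
      have := Fintype.ofFinite (factors 𝒢 F)
      rw [finsum_eq_sum_of_fintype]
      have h1 : ∀ i : factors 𝒢 F,
          rk M ((i : Flat M) : Set α) ≤ (I ∩ ((i : Flat M) : Set α)).ncard := by
        intro i
        calc rk M ((i : Flat M) : Set α) ≤ rk M (M.closure (I ∩ ((i : Flat M) : Set α))) :=
              rk_mono (hG i i.2)
          _ = _ := by rw [rk_closure, rk_indep (hI.subset Set.inter_subset_left)]
      refine (Finset.sum_le_sum fun i _ => h1 i).trans ?_
      have h2 : Pairwise (Function.onFun Disjoint
          fun i : factors 𝒢 F => I ∩ ((i : Flat M) : Set α)) := fun i j hij =>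
        (hd i.2 j.2 (Subtype.coe_ne_coe.2 hij)).mono Set.inter_subset_right Set.inter_subset_right
      rw [← finsum_eq_sum_of_fintype, ← Set.ncard_iUnion_of_finite (fun _ => Set.toFinite _) h2]
      exact (ncard_le_rk (hI.subset (Set.iUnion_subset fun i => Set.inter_subset_left))
        (Set.iUnion_subset fun i => Set.inter_subset_left.trans hIF))
  refine ⟨exists_orderIso_of_rk_le hl hc hr, le_antisymm ?_ hr⟩
  have := Fintype.ofFinite (factors 𝒢 F)
  rw [finsum_eq_sum_of_fintype]
  refine le_trans (rk_mono fun e he => ?_) (rk_iUnion_le Finset.univ _)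
  simpa using hc e he

end BuildingSet
-- Connected restrictions and the minimal building set
section Connected

/-- The flats of the restriction to a flat `F` are the flats contained in `F`. -/
def flatRestrictIso {M : Matroid α} (F : Flat M) :
    Flat (M.restrict (F : Set α)) ≃o Set.Iic F :=
  have key : ∀ K : Set α, (M.restrict (F : Set α)).IsFlat K ↔ M.IsFlat K ∧ K ⊆ F := by
    intro K
    have hcl : ∀ hK : K ⊆ F, (M.restrict (F : Set α)).closure K = M.closure K := fun hK => by
      rw [M.restrict_closure_eq hK F.2.subset_ground, Set.inter_eq_left]
      exact (M.closure_subset_closure hK).trans F.2.closure.subset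
    refine ⟨fun h => ?_, fun h => ?_⟩
    · have hK : K ⊆ F := h.subset_ground
      exact ⟨Matroid.isFlat_iff_closure_eq.2 ((hcl hK).symm.trans h.closure), hK⟩
    · exact Matroid.isFlat_iff_closure_eq.2 ((hcl h.2).trans h.1.closure)
  { toFun K := ⟨⟨K, ((key _).1 K.2).1⟩, ((key _).1 K.2).2⟩
    invFun K := ⟨(K : Flat M), (key _).2 ⟨(K : Flat M).2, K.2⟩⟩
    left_inv _ := rfl
    right_inv _ := rfl
    map_rel_iff' := Iff.rfl }

theorem not_isConnected_of_orderIso_pi {M : Matroid α} {F : Flat M} {ι : Type u} {G : ι → Flat M}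
    (φ : (∀ i, Set.Iic (G i)) ≃o Set.Iic F) {i j : ι} (hij : i ≠ j)
    (hne : ∀ i, ∃ K, K < G i) : ¬ IsConnected (M.restrict (F : Set α)) := by
  classical
  rw [IsConnected, not_not]
  have hnt : ∀ k, Nontrivial (Set.Iic (G k)) := fun k => by
    obtain ⟨K, hK⟩ := hne k
    exact ⟨⟨K, hK.le⟩, ⟨G k, Set.mem_Iic.2 le_rfl⟩, fun h => hK.ne (congrArg Subtype.val h)⟩
  have : Inhabited {k // k ≠ i} := ⟨⟨j, hij.symm⟩⟩
  refine ⟨Set.Iic (G i), ∀ k : {k // k ≠ i}, Set.Iic (G k), inferInstance, inferInstance,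
    hnt i, Pi.nontrivial, ⟨(flatRestrictIso F).trans (φ.symm.trans
      ⟨Equiv.piSplitAt i fun k => Set.Iic (G k), ?_⟩)⟩⟩
  intro x y
  refine ⟨fun h k => ?_, fun h => ⟨h i, fun k => h k⟩⟩
  by_cases hk : k = i
  · subst hk
    exact h.1
  · exact h.2 ⟨k, hk⟩

/-- A matroid is connected if any two distinct nonloops avoid a common hyperplane. -/
theorem isConnected_of_hyperplane {M : Matroid α}
    (h : ∀ e ∈ M.E, ∀ f ∈ M.E, e ≠ f → ∃ H : Flat M, e ∉ (H : Set α) ∧ f ∉ (H : Set α) ∧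
      ∀ K : Flat M, H < K → (K : Set α) = M.E) : IsConnected M := by
  rintro ⟨L₁, L₂, _, _, h1, h2, ⟨φ⟩⟩
  let T : Flat M := ⟨M.E, M.ground_isFlat⟩
  let B : Flat M := ⟨M.closure ∅, M.isFlat_closure _⟩
  have hT : ∀ K : Flat M, K ≤ T := fun K => K.2.subset_ground
  have hB : ∀ K : Flat M, B ≤ K := fun K =>
    (M.closure_subset_closure (Set.empty_subset _)).trans K.2.closure.subset
  have hT1 : ∀ x y, (x, y) ≤ φ T := fun x y => φ.symm_apply_le.1 (hT (φ.symm (x, y)))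
  have hB1 : ∀ x y, φ B ≤ (x, y) := fun x y => φ.le_symm_apply.1 (hB (φ.symm (x, y)))
  have n1 : (φ B).1 ≠ (φ T).1 := by
    intro he
    obtain ⟨x, y, hxy⟩ := h1
    have : ∀ z, z = (φ B).1 := fun z =>
      le_antisymm (he ▸ (hT1 z (φ T).2).1) (hB1 z (φ T).2).1
    exact hxy ((this x).trans (this y).symm)
  have n2 : (φ B).2 ≠ (φ T).2 := by
    intro he
    obtain ⟨x, y, hxy⟩ := h2
    have : ∀ z, z = (φ B).2 := fun z =>
      le_antisymm (he ▸ (hT1 (φ T).1 z).2) (hB1 (φ T).1 z).2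
    exact hxy ((this x).trans (this y).symm)
  -- `P` and `Q` are (top, bottom) and (bottom, top). They meet in the loops, so nonloops `e` in `P`
  -- and `f` in `Q` are distinct.
  let P : Flat M := φ.symm ((φ T).1, (φ B).2)
  let Q : Flat M := φ.symm ((φ B).1, (φ T).2)
  have hP : ¬ P ≤ B := fun hle => n1 (le_antisymm (hB1 _ (φ T).2).1 (φ.symm_apply_le.1 hle).1)
  have hQ : ¬ Q ≤ B := fun hle => n2 (le_antisymm (hB1 (φ T).1 _).2 (φ.symm_apply_le.1 hle).2)
  obtain ⟨e, heP, heB⟩ := Set.not_subset.1 hP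
  obtain ⟨f, hfQ, hfB⟩ := Set.not_subset.1 hQ
  have hef : e ≠ f := by
    rintro rfl
    have : P ⊓ Q ≤ B := by
      rw [← φ.le_iff_le]
      have h1 : φ (P ⊓ Q) ≤ φ P := φ.monotone inf_le_left
      have h2 : φ (P ⊓ Q) ≤ φ Q := φ.monotone inf_le_right
      simp only [P, Q, φ.apply_symm_apply] at h1 h2
      exact ⟨h2.1, h1.2⟩
    exact heB (this ⟨heP, hfQ⟩)
  obtain ⟨H, heH, hfH, hH⟩ := h e (P.2.subset_ground heP) f (Q.2.subset_ground hfQ) hef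
  -- A hyperplane of a product has top as one of its coordinates, so it contains `P` or `Q`, and
  -- hence `e` or `f`.
  by_cases h1 : (φ H).1 = (φ T).1
  · have : P ≤ H := φ.symm_apply_le.2 ⟨h1.ge, (hB1 (φ T).1 _).2⟩
    exact heH (this heP)
  · let K : Flat M := φ.symm ((φ H).1, (φ T).2)
    have hHK : H ≤ K := φ.le_symm_apply.2 ⟨le_rfl, (hT1 (φ T).1 (φ H).2).2⟩
    have hQK : Q ≤ K := φ.symm.monotone ⟨(hB1 _ (φ T).2).1, le_rfl⟩
    rcases hHK.eq_or_lt with h' | h'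
    · exact hfH (h' ▸ hQK hfQ)
    · have hKT : K = T := Subtype.ext (hH K h')
      apply h1
      rw [← hKT]
      simp [K]

/-- A building set all of whose members are connected is the minimal one. -/
theorem minBuildingSet_eq {M : Matroid α} [M.Loopless] {𝒢 : Set (Flat M)} (h𝒢 : IsBuildingSet 𝒢)
    (hc : ∀ G ∈ 𝒢, IsConnected (M.restrict (G : Set α))) : minBuildingSet M = 𝒢 := by
  ext F
  refine ⟨fun ⟨hF, hF'⟩ => ?_, fun h => ⟨h𝒢.1 F h, hc F h⟩⟩
  by_contra hF𝒢
  obtain ⟨φ, hφ⟩ := (h𝒢.2 F).1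
  let B : Flat M := ⟨M.closure ∅, M.isFlat_closure _⟩
  have hB : (B : Set α) = ∅ := M.loops_eq_empty
  have hlt : ∀ G : Flat M, (G : Set α).Nonempty → B < G := fun G hG =>
    Subtype.coe_lt_coe.1 (by
      rw [hB]
      exact Set.empty_ssubset.2 hG)
  -- The factors join to `F`, so no smaller flat bounds them all. Applied to the bottom flat and
  -- then to a first factor, which differs from `F`, this yields two distinct factors.
  have key : ∀ K : Flat M, K < F → ∃ G : factors 𝒢 F, ¬ (G : Flat M) ≤ K := by
    intro K hK
    by_contra! hG
    have h1 := hφ (φ.symm ⟨F, Set.mem_Iic.2 le_rfl⟩)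
    rw [φ.apply_symm_apply] at h1
    refine hK.not_ge (h1.trans_le ((isLUB_join _).2 ?_))
    rintro _ ⟨G, rfl⟩
    exact le_trans (Subtype.prop (φ.symm ⟨F, Set.mem_Iic.2 le_rfl⟩ G)) (hG G)
  obtain ⟨G₁, -⟩ := key B (hlt F hF)
  obtain ⟨G₂, h2⟩ := key G₁ (lt_of_le_of_ne G₁.2.1.2 fun h => hF𝒢 (h ▸ G₁.2.1.1))
  exact not_isConnected_of_orderIso_pi φ (i := G₁) (j := G₂) (fun h => h2 (h ▸ le_rfl))
    (fun G => ⟨B, hlt _ (h𝒢.1 _ G.2.1.1)⟩) hF'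

/-- The closure of `J` is a hyperplane of the restriction by the rank bound, and it avoids `e` and
`f` because each extends `J` independently. -/
theorem isConnected_restrict [Finite α] {M : Matroid α} {F : Flat M} (h : ∀ e ∈ (F : Set α), ∀ f ∈ (F : Set α), e ≠ f →
    ∃ J : Set α, J ⊆ F ∧ e ∉ J ∧ f ∉ J ∧ M.Indep (insert e J) ∧ M.Indep (insert f J) ∧
      rk M (F : Set α) ≤ J.ncard + 1) : IsConnected (M.restrict (F : Set α)) := by
  refine isConnected_of_hyperplane fun e he f hf hef => ?_
  obtain ⟨J, hJF, heJ, hfJ, hIe, hIf, hr⟩ := h e he f hf hef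
  have hJ : M.Indep J := hIe.subset (Set.subset_insert _ _)
  let H : Flat M := ⟨M.closure J, M.isFlat_closure _⟩
  have hHF : H ≤ F := (M.closure_subset_closure hJF).trans F.2.closure.subset
  let H' := (flatRestrictIso F).symm ⟨H, hHF⟩
  refine ⟨H', (hJ.insert_indep_iff_of_notMem heJ).1 hIe |>.2,
    (hJ.insert_indep_iff_of_notMem hfJ).1 hIf |>.2, fun K hK => ?_⟩
  have h1 : H < ((flatRestrictIso F) K : Flat M) :=
    (flatRestrictIso F).symm_apply_lt.1 hK
  have h2 := rk_lt_of_lt h1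
  have h3 : rk M (H : Set α) = J.ncard := by rw [rk_closure, rk_indep hJ]
  exact congrArg Subtype.val (eq_of_le_of_rk_le ((flatRestrictIso F) K).2 (by omega))

end Connected

/-! ### Substitutions that detect independent monomials -/

section ChainHom

variable {M : Matroid α} {𝒢 : Set (Flat M)}

/-- The rank of an element of `𝒢`. -/
noncomputable abbrev rkElt (H : 𝒢) : ℕ := rk M ((H : Flat M) : Set α)

/-- The exponent `rk G - rk sup(S, G)` in the relation attached to `S` and `G`. -/
noncomputable abbrev relExponent (S : Finset 𝒢) (G : 𝒢) : ℕ :=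
  rkElt G - rk M (supBelow {H | ∃ h : H ∈ 𝒢, (⟨H, h⟩ : 𝒢) ∈ S} (G : Flat M) : Set α)

theorem chowRelation_mem (S : Finset 𝒢) (G : 𝒢) : chowRelation 𝒢 S G ∈ chowIdeal 𝒢 :=
  Ideal.subset_span ⟨S, G, rfl⟩

variable [Fintype 𝒢]

open Classical in
theorem chowRelation_eq (S : Finset 𝒢) (G : 𝒢) : chowRelation 𝒢 S G =
    (∏ H ∈ S, X H) * (∑ H : 𝒢, if (G : Flat M) ≤ H then X H else 0) ^ relExponent S G := by
  simp only [chowRelation, finsum_eq_if, finsum_eq_sum_of_fintype]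

open Classical in
/-- The substitution which keeps the variables in `𝒞`, eliminates the variables of rank one by the
linear relations, and kills all the other variables. -/
noncomputable def chainHom (𝒞 : Set 𝒢) : MvPolynomial 𝒢 ℚ →ₐ[ℚ] MvPolynomial 𝒢 ℚ :=
  aeval fun H => if H ∈ 𝒞 then X H else
    if rkElt H = 1 then -∑ K : 𝒢, if K ∈ 𝒞 ∧ (H : Flat M) ≤ K then X K else 0 else 0

theorem chainHom_X_mem {𝒞 : Set 𝒢} {H : 𝒢} (h : H ∈ 𝒞) : chainHom 𝒞 (X H) = X H := by
  simp [chainHom, h]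

open Classical in
theorem chainHom_X_rk_one {𝒞 : Set 𝒢} {H : 𝒢} (h : H ∉ 𝒞) (h1 : rkElt H = 1) :
    chainHom 𝒞 (X H) = -∑ K : 𝒢, if K ∈ 𝒞 ∧ (H : Flat M) ≤ K then X K else 0 := by
  simp [chainHom, h, h1]

theorem chainHom_X_eq_zero {𝒞 : Set 𝒢} {H : 𝒢} (h : H ∉ 𝒞) (h1 : rkElt H ≠ 1) :
    chainHom 𝒞 (X H) = 0 := by
  simp [chainHom, h, h1]

theorem mem_or_of_chainHom_X_ne_zero {𝒞 : Set 𝒢} {H : 𝒢} (h : chainHom 𝒞 (X H) ≠ 0) :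
    H ∈ 𝒞 ∨ rkElt H = 1 ∧ ∃ K ∈ 𝒞, (H : Flat M) ≤ K := by
  classical
  by_contra! hc
  obtain ⟨h1, h2⟩ := hc
  by_cases h3 : rkElt H = 1
  · refine h ?_
    rw [chainHom_X_rk_one h1 h3, Finset.sum_eq_zero, neg_zero]
    intro K _
    rw [if_neg fun hK => h2 h3 K hK.1 hK.2]
  · exact h (chainHom_X_eq_zero h1 h3)

theorem isHomogeneous_chainHom_X (𝒞 : Set 𝒢) (H : 𝒢) : (chainHom 𝒞 (X H)).IsHomogeneous 1 := by
  classical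
  by_cases h : H ∈ 𝒞
  · rw [chainHom_X_mem h]
    exact isHomogeneous_X _ _
  by_cases h1 : rkElt H = 1
  · rw [chainHom_X_rk_one h h1]
    refine (IsHomogeneous.sum _ _ _ fun K _ => ?_).neg
    split_ifs
    exacts [isHomogeneous_X _ _, isHomogeneous_zero _ _ _]
  · rw [chainHom_X_eq_zero h h1]
    exact isHomogeneous_zero _ _ _

theorem isHomogeneous_chainHom_chowRelation (𝒞 : Set 𝒢) (S : Finset 𝒢) (G : 𝒢) :
    (chainHom 𝒞 (chowRelation 𝒢 S G)).IsHomogeneous (S.card + relExponent S G) := by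
  classical
  rw [chowRelation_eq, map_mul, map_prod, map_pow, map_sum]
  refine IsHomogeneous.mul ?_ ?_
  · simpa using IsHomogeneous.prod S _ (fun _ => 1) fun H _ => isHomogeneous_chainHom_X 𝒞 H
  · have : (∑ H : 𝒢, chainHom 𝒞 (if (G : Flat M) ≤ H then X H else 0)).IsHomogeneous 1 := by
      refine IsHomogeneous.sum _ _ _ fun H _ => ?_
      split_ifs
      · exact isHomogeneous_chainHom_X 𝒞 H
      · rw [map_zero]
        exact isHomogeneous_zero _ _ _
    simpa using this.pow (relExponent S G)

/-- Up to terms of degree at least `4`, the substitution `chainHom 𝒞` kills the Chow ideal. -/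
def IsCompatible (𝒞 : Set 𝒢) : Prop :=
  ∀ (S : Finset 𝒢) (G : 𝒢),
    chainHom 𝒞 (chowRelation 𝒢 S G) = 0 ∨ 4 ≤ S.card + relExponent S G

/-- Images of generators are homogeneous, so those that survive start in degree 4; multiplying by
polynomials cannot lower the degree. -/
theorem coeff_chainHom_eq_zero {𝒞 : Set 𝒢} (h𝒞 : IsCompatible 𝒞) {p : MvPolynomial 𝒢 ℚ}
    (hp : p ∈ chowIdeal 𝒢) : ∀ m : 𝒢 →₀ ℕ, m.degree ≤ 3 → coeff m (chainHom 𝒞 p) = 0 := by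
  classical
  induction hp using Submodule.span_induction with
  | mem p hp =>
    obtain ⟨S, G, rfl⟩ := hp
    intro m hm
    rcases h𝒞 S G with h | h
    · rw [h, coeff_zero]
    · exact (isHomogeneous_chainHom_chowRelation 𝒞 S G).coeff_eq_zero (by omega)
  | zero => simp
  | add p q _ _ hp hq =>
    intro m hm
    rw [map_add, coeff_add, hp m hm, hq m hm, add_zero]
  | smul a p _ hp =>
    intro m hm
    rw [smul_eq_mul, map_mul, coeff_mul]
    refine Finset.sum_eq_zero fun x hx => ?_
    have : x.1.degree + x.2.degree = m.degree := by
      rw [← map_add, Finset.HasAntidiagonal.mem_antidiagonal.1 hx]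
    rw [hp x.2 (by omega), mul_zero]

theorem chainHom_monomial_of_subset {𝒞 : Set 𝒢} {m : 𝒢 →₀ ℕ} (h : ∀ H ∈ m.support, H ∈ 𝒞) :
    chainHom 𝒞 (monomial m 1) = monomial m 1 := by
  rw [monomial_eq, map_mul, Finsupp.prod, map_prod]
  congr 1
  · simp [chainHom]
  · exact Finset.prod_congr rfl fun H hH => by rw [map_pow, chainHom_X_mem (h H hH)]

theorem chainHom_monomial_of_not_subset {𝒞 : Set 𝒢} {m : 𝒢 →₀ ℕ} {H : 𝒢} (hH : H ∈ m.support)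
    (hH' : H ∉ 𝒞) (h1 : rkElt H ≠ 1) : chainHom 𝒞 (monomial m 1) = 0 := by
  rw [monomial_eq, map_mul, Finsupp.prod, map_prod]
  rw [Finset.prod_eq_zero hH, mul_zero]
  rw [map_pow, chainHom_X_eq_zero hH' h1, zero_pow (Finsupp.mem_support_iff.1 hH)]

omit [Fintype 𝒢] in
theorem finite_chowPiece [Finite 𝒢] (d : ℕ) : Module.Finite ℚ (chowPiece 𝒢 d) :=
  Module.Finite.iff_fg.2 ((homogeneousSubmodule_fg 𝒢 ℚ d).map _)

/-- Monomials of degree at most `3` supported on compatible sets of variables of rank other than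
one are linearly independent in the Chow ring. -/
theorem card_le_finrank_chowPiece {κ : Type*} [Fintype κ] (m : κ → 𝒢 →₀ ℕ)
    (hm : Function.Injective m) {d : ℕ} (hd : d ≤ 3) (hdeg : ∀ k, (m k).degree = d)
    (hrk : ∀ k, ∀ H ∈ (m k).support, rkElt H ≠ 1)
    (h𝒞 : ∀ k, ∃ 𝒞 : Set 𝒢, IsCompatible 𝒞 ∧ ∀ H ∈ (m k).support, H ∈ 𝒞) :
    Fintype.card κ ≤ Module.finrank ℚ (chowPiece 𝒢 d) := by
  classical
  have := finite_chowPiece (𝒢 := 𝒢) d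
  let w : κ → chowPiece 𝒢 d := fun k => ⟨Ideal.Quotient.mkₐ ℚ (chowIdeal 𝒢) (monomial (m k) 1),
    Submodule.mem_map_of_mem (isHomogeneous_monomial _ (hdeg k))⟩
  refine LinearIndependent.fintype_card_le_finrank (b := w) ?_
  rw [Fintype.linearIndependent_iff]
  intro g hg k
  have h1 : Ideal.Quotient.mkₐ ℚ (chowIdeal 𝒢) (∑ j, g j • monomial (m j) 1) = 0 := by
    rw [map_sum]
    simpa [w] using congrArg Subtype.val hg
  have h2 := Ideal.Quotient.eq_zero_iff_mem.1 h1
  -- The substitution depends on `k`. It fixes the `k`-th monomial, and each other monomial is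
  -- either fixed, hence different, or contains a killed variable. So the coefficient at `m k`
  -- isolates `g k`.
  obtain ⟨𝒞, hC, hk⟩ := h𝒞 k
  have h3 := coeff_chainHom_eq_zero hC h2 (m k) (by rw [hdeg]; exact hd)
  rw [map_sum, coeff_sum, Finset.sum_eq_single k] at h3
  · simpa [chainHom_monomial_of_subset hk] using h3
  · intro j _ hj
    rw [map_smul, coeff_smul]
    by_cases hs : ∀ H ∈ (m j).support, H ∈ 𝒞
    · rw [chainHom_monomial_of_subset hs, coeff_monomial, if_neg fun h => hj (hm h), smul_zero]
    · push Not at hs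
      obtain ⟨H, hH, hH'⟩ := hs
      rw [chainHom_monomial_of_not_subset hH hH' (hrk j H hH), coeff_zero, smul_zero]
  · simp

end ChainHom

/-! ### Degrees of the relations -/

section Degrees

variable [Finite α] {M : Matroid α} {𝒢 : Set (Flat M)}

/-- Each rank-one member outside `K` raises the rank of the join by at most one. `R` lists the
members charged in this way. -/
theorem rk_supBelow_le [DecidableEq 𝒢] (S : Finset 𝒢) (G : 𝒢) (K : Flat M) (R : Finset 𝒢)
    (h : ∀ H ∈ S, (H : Flat M) < G → (H : Flat M) ≤ K ∨ H ∈ R ∧ rkElt H = 1) :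
    rk M (supBelow {H | ∃ h : H ∈ 𝒢, (⟨H, h⟩ : 𝒢) ∈ S} (G : Flat M) : Set α) ≤
      rk M (K : Set α) + R.card := by
  let R' := R.filter fun H => rkElt H = 1
  rw [supBelow, join, rk_closure]
  calc _ ≤ rk M ((K : Set α) ∪ ⋃ H ∈ R', ((H : Flat M) : Set α)) := rk_mono ?_
    _ ≤ rk M (K : Set α) + ∑ H ∈ R', rkElt H :=
      (rk_union_le M _ _).trans (Nat.add_le_add_left (rk_iUnion_le R' _) _)
    _ = rk M (K : Set α) + R'.card := by
      rw [Finset.card_eq_sum_ones, Finset.sum_congr rfl fun H hH => (Finset.mem_filter.1 hH).2]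
    _ ≤ _ := Nat.add_le_add_left (Finset.card_filter_le _ _) _
  refine Set.iUnion₂_subset ?_
  rintro H ⟨⟨hH𝒢, hHS⟩, hHG⟩
  rcases h ⟨H, hH𝒢⟩ hHS hHG with h | ⟨h, h'⟩
  · exact fun e he => Or.inl (h he)
  · exact fun e he => Or.inr (Set.mem_iUnion₂.2 ⟨⟨H, hH𝒢⟩, Finset.mem_filter.2 ⟨h, h'⟩, he⟩)

/-- A rank-one member of `S` lowers the exponent by at most one but contributes a factor of degree
one. -/
theorem rkElt_le_degree {S : Finset 𝒢} {G : 𝒢}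
    (h : ∀ H ∈ S, (H : Flat M) < G → rkElt H = 1) : rkElt G ≤ S.card + relExponent S G := by
  classical
  have := rk_supBelow_le S G ⟨M.closure ∅, M.isFlat_closure _⟩ S fun H hH hHG =>
    Or.inr ⟨hH, h H hH hHG⟩
  simp only [rk_closure, rk_empty] at this
  simp only [relExponent]
  omega

/-- The relation has degree at least `rk G - rk K + 1`: the extra one is the factor `x_K` itself.
This is why jumps of 3 above `A` and `B` suffice to reach degree 4. -/
theorem rkElt_lt_degree {S : Finset 𝒢} {G K : 𝒢} (hK : K ∈ S)
    (h : ∀ H ∈ S, (H : Flat M) < G → (H : Flat M) ≤ K ∨ rkElt H = 1) :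
    rkElt G + 1 ≤ S.card + relExponent S G + rkElt K := by
  classical
  have := rk_supBelow_le S G K (S.erase K) fun H hH hHG => by
    rcases h H hH hHG with h | h
    · exact Or.inl h
    · by_cases hHK : H = K
      · exact Or.inl (hHK ▸ le_rfl)
      · exact Or.inr ⟨Finset.mem_erase.2 ⟨hHK, hH⟩, h⟩
  have h2 := Finset.card_erase_add_one hK
  simp only [relExponent, rkElt] at *
  omega

theorem relExponent_pos {S : Finset 𝒢} {G K : 𝒢} (hK : (K : Flat M) < G)
    (h : ∀ H ∈ S, (H : Flat M) < G → (H : Flat M) ≤ K) : 0 < relExponent S G := by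
  classical
  have := rk_supBelow_le S G K ∅ fun H hH hHG => Or.inl (h H hH hHG)
  have h2 := rk_lt_of_lt hK
  simp only [relExponent, rkElt, Finset.card_empty] at *
  omega

theorem relExponent_le {S : Finset 𝒢} {G : 𝒢} {n : ℕ} (K : Flat M)
    (h : ∀ L : Flat M, (∀ H ∈ S, (H : Flat M) < G → (H : Flat M) ≤ L) → K ≤ L)
    (hn : rkElt G ≤ rk M (K : Set α) + n) : relExponent S G ≤ n := by
  have h1 : K ≤ supBelow {H | ∃ h : H ∈ 𝒢, (⟨H, h⟩ : 𝒢) ∈ S} (G : Flat M) :=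
    h _ fun H hH hHG => (isLUB_join _).1 ⟨⟨H.2, hH⟩, hHG⟩
  have h2 := rk_mono (M := M) (Subtype.coe_le_coe.2 h1)
  simp only [relExponent]
  omega

end Degrees

/-! ### The flag with seven hyperplanes, and its compatible sets of variables -/

/-- The members of `𝒢` are a flag `A < B < T` with large jumps, seven hyperplanes which do not
contain `A`, and flats of rank one. -/
structure FlagWithHyperplanes {M : Matroid α} (𝒢 : Set (Flat M)) where
  A : 𝒢
  B : 𝒢
  T : 𝒢
  C : Fin 7 → 𝒢
  A_le_B : (A : Flat M) ≤ B
  B_le_T : (B : Flat M) ≤ T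
  C_le_T : ∀ i, (C i : Flat M) ≤ T
  not_A_le_C : ∀ i, ¬ (A : Flat M) ≤ C i
  C_injective : Function.Injective C
  rk_A : 4 ≤ rkElt A
  rk_B : rkElt A + 3 ≤ rkElt B
  rk_T : rkElt B + 3 ≤ rkElt T
  rk_C : ∀ i, rkElt (C i) + 1 = rkElt T
  eq_or : ∀ H : 𝒢, H = A ∨ H = B ∨ H = T ∨ (∃ i, H = C i) ∨ rkElt H = 1

/-- No member of `𝒢` is strictly below `G`, so the exponent is 1. The substitution sends `x_G` to
minus the sum of the kept variables above `G`, and kills the other variables above `G`, so the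
linear factor cancels. -/
theorem chainHom_chowRelation_rk_one [Finite α] {M : Matroid α} {𝒢 : Set (Flat M)} [Fintype 𝒢]
    {𝒞 : Set 𝒢} (h𝒞 : ∀ H ∈ 𝒞, rkElt H ≠ 1) (h0 : ∀ H : 𝒢, rkElt H ≠ 0) (S : Finset 𝒢) {G : 𝒢}
    (hG : rkElt G = 1) : chainHom 𝒞 (chowRelation 𝒢 S G) = 0 := by
  classical
  have h1 : relExponent S G = 1 := by
    have h2 := rk_supBelow_le S G ⟨M.closure ∅, M.isFlat_closure _⟩ ∅ fun H _ hHG =>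
      absurd (rk_lt_of_lt hHG) (by have := h0 H; simp only [rkElt] at *; omega)
    simp only [rk_closure, rk_empty, Finset.card_empty] at h2
    simp only [relExponent, hG]
    omega
  have hG𝒞 : G ∉ 𝒞 := fun h => h𝒞 G h hG
  rw [chowRelation_eq, h1, pow_one, map_mul, map_sum]
  have h2 : ∀ H : 𝒢, chainHom 𝒞 (if (G : Flat M) ≤ H then X H else 0) =
      (if H = G then chainHom 𝒞 (X G) else 0) +
        if H ∈ 𝒞 ∧ (G : Flat M) ≤ H then X H else 0 := by
    intro H
    by_cases hHG : H = G
    · subst hHG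
      simp [hG𝒞]
    by_cases hle : (G : Flat M) ≤ H
    · by_cases hH : H ∈ 𝒞
      · simp [hHG, hle, hH, chainHom_X_mem hH]
      · have : rkElt H ≠ 1 := fun h =>
          hHG (Subtype.ext (eq_of_le_of_rk_le hle (h.trans hG.symm).le)).symm
        simp [hHG, hle, hH, chainHom_X_eq_zero hH this]
    · simp [hHG, hle]
  rw [Finset.sum_congr rfl fun H _ => h2 H, Finset.sum_add_distrib,
    Finset.sum_ite_eq' Finset.univ G, if_pos (Finset.mem_univ _), chainHom_X_rk_one hG𝒞 hG,
    neg_add_cancel, mul_zero]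

theorem forall_of_chainHom_ne_zero {M : Matroid α} {𝒢 : Set (Flat M)} [Fintype 𝒢] {𝒞 : Set 𝒢}
    {S : Finset 𝒢} {G : 𝒢} (h : chainHom 𝒞 (chowRelation 𝒢 S G) ≠ 0) :
    ∀ H ∈ S, H ∈ 𝒞 ∨ rkElt H = 1 ∧ ∃ K ∈ 𝒞, (H : Flat M) ≤ K := by
  intro H hH
  refine mem_or_of_chainHom_X_ne_zero fun h0 => h ?_
  rw [chowRelation_eq, map_mul, map_prod, Finset.prod_eq_zero hH h0, zero_mul]

namespace FlagWithHyperplanes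

variable {M : Matroid α} {𝒢 : Set (Flat M)} (c : FlagWithHyperplanes 𝒢)

include c

theorem rk_ne_zero (H : 𝒢) : rkElt H ≠ 0 := by
  have h1 := c.rk_A
  have h2 := c.rk_B
  have h3 := c.rk_T
  rcases c.eq_or H with rfl | rfl | rfl | ⟨i, rfl⟩ | h
  · omega
  · omega
  · omega
  · have := c.rk_C i
    omega
  · omega

theorem not_B_le_C (i : Fin 7) : ¬ (c.B : Flat M) ≤ c.C i := fun h =>
  c.not_A_le_C i (c.A_le_B.trans h)

variable [Finite α]

theorem eq_of_T_le {H : 𝒢} (h : (c.T : Flat M) ≤ H) : H = c.T := by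
  have h0 : rkElt c.T ≤ rkElt H := rk_mono h
  have h1 := c.rk_A
  have h2 := c.rk_B
  have h3 := c.rk_T
  rcases c.eq_or H with rfl | rfl | rfl | ⟨i, rfl⟩ | h
  · omega
  · omega
  · rfl
  · have := c.rk_C i
    omega
  · omega

theorem not_C_le_B (i : Fin 7) : ¬ (c.C i : Flat M) ≤ c.B := fun h => by
  have h1 : rkElt (c.C i) ≤ rkElt c.B := rk_mono h
  have h2 := c.rk_C i
  have h3 := c.rk_T
  omega

theorem rk_eq_one_of_lt_C {S : Finset 𝒢} {i : Fin 7} :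
    ∀ H ∈ S, (H : Flat M) < c.C i → rkElt H = 1 := by
  intro H _ hH
  have hr := rk_lt_of_lt hH
  rcases c.eq_or H with rfl | rfl | rfl | ⟨j, rfl⟩ | h
  · exact absurd hH.le (c.not_A_le_C i)
  · exact absurd hH.le (c.not_B_le_C i)
  · exact absurd (c.C_le_T i) hH.not_ge
  · have h1 := c.rk_C i
    have h2 := c.rk_C j
    simp only [rkElt] at *
    omega
  · exact h

variable [Fintype 𝒢]

/-- If the image is nonzero, `S` contains only flag members and rank-one flats. The largest flag
member of `S` strictly below `G`, if any, is at least 3 ranks lower, and the degree bounds give 4.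
-/
theorem isCompatible_flag : IsCompatible ({c.A, c.B, c.T} : Set 𝒢) := by
  intro S G
  rw [or_iff_not_imp_left]
  intro hne
  have h1 := c.rk_A
  have h2 := c.rk_B
  have h3 := c.rk_T
  have hS := forall_of_chainHom_ne_zero hne
  have hS' : ∀ H ∈ S, H = c.A ∨ H = c.B ∨ H = c.T ∨ rkElt H = 1 := fun H hH => by
    have := hS H hH
    simp only [Set.mem_insert_iff, Set.mem_singleton_iff] at this
    tauto
  rcases c.eq_or G with rfl | rfl | rfl | ⟨i, rfl⟩ | h
  · refine h1.trans (rkElt_le_degree fun H hH hlt => ?_)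
    rcases hS' H hH with rfl | rfl | rfl | h
    · exact absurd rfl hlt.ne
    · exact absurd c.A_le_B hlt.not_ge
    · exact absurd (c.A_le_B.trans c.B_le_T) hlt.not_ge
    · exact h
  · by_cases hA : c.A ∈ S
    · have := rkElt_lt_degree (G := c.B) hA fun H hH hlt => by
        rcases hS' H hH with rfl | rfl | rfl | h
        · exact Or.inl le_rfl
        · exact absurd rfl hlt.ne
        · exact absurd c.B_le_T hlt.not_ge
        · exact Or.inr h
      omega
    · have := rkElt_le_degree (S := S) (G := c.B) fun H hH hlt => by
        rcases hS' H hH with rfl | rfl | rfl | h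
        · exact absurd hH hA
        · exact absurd rfl hlt.ne
        · exact absurd c.B_le_T hlt.not_ge
        · exact h
      omega
  · by_cases hB : c.B ∈ S
    · have := rkElt_lt_degree (G := c.T) hB fun H hH hlt => by
        rcases hS' H hH with rfl | rfl | rfl | h
        · exact Or.inl c.A_le_B
        · exact Or.inl le_rfl
        · exact absurd rfl hlt.ne
        · exact Or.inr h
      omega
    by_cases hA : c.A ∈ S
    · have := rkElt_lt_degree (G := c.T) hA fun H hH hlt => by
        rcases hS' H hH with rfl | rfl | rfl | h
        · exact Or.inl le_rfl
        · exact absurd hH hB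
        · exact absurd rfl hlt.ne
        · exact Or.inr h
      omega
    · have := rkElt_le_degree (S := S) (G := c.T) fun H hH hlt => by
        rcases hS' H hH with rfl | rfl | rfl | h
        · exact absurd hH hA
        · exact absurd hH hB
        · exact absurd rfl hlt.ne
        · exact h
      omega
  · have := rkElt_le_degree (S := S) c.rk_eq_one_of_lt_C (G := c.C i)
    have := c.rk_C i
    omega
  · refine absurd (chainHom_chowRelation_rk_one ?_ c.rk_ne_zero S h) hne
    rintro H (rfl | rfl | rfl) <;> omega

/-- The only `G` strictly above `C i` is `T`; for every other `G` of rank above one, the surviving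
members of `S` strictly below it have rank one and the degree is at least `rk G`. -/
theorem isCompatible_hyperplane (i : Fin 7) : IsCompatible ({c.C i} : Set 𝒢) := by
  classical
  intro S G
  rw [or_iff_not_imp_left]
  intro hne
  have h1 := c.rk_A
  have h2 := c.rk_B
  have h3 := c.rk_T
  have h4 := c.rk_C i
  have hS := forall_of_chainHom_ne_zero hne
  simp only [Set.mem_singleton_iff, exists_eq_left] at hS
  have hlt : ∀ H ∈ S, (H : Flat M) < G → ¬ (c.C i : Flat M) < G → rkElt H = 1 := by
    intro H hH hHG hC
    rcases hS H hH with rfl | h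
    · exact absurd hHG hC
    · exact h.1
  rcases c.eq_or G with rfl | rfl | rfl | ⟨j, rfl⟩ | h
  · exact h1.trans (rkElt_le_degree fun H hH hHG => hlt H hH hHG fun h =>
      c.not_C_le_B i (h.le.trans c.A_le_B))
  · have := rkElt_le_degree (S := S) (G := c.B) fun H hH hHG => hlt H hH hHG fun h =>
      c.not_C_le_B i h.le
    omega
  -- For `G = T` the degree may be small, but all of `S` lies below `C i`, so the exponent is
  -- positive and the killed variable `x_T` appears as a factor.
  · exfalso
    apply hne
    have hCT : (c.C i : Flat M) < c.T := lt_of_le_of_ne (c.C_le_T i) fun h => by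
      have := congrArg (fun F : Flat M => rk M (F : Set α)) h
      simp only [rkElt] at *
      omega
    have hpos := relExponent_pos (S := S) hCT fun H hH _ => by
      rcases hS H hH with rfl | h
      · exact le_rfl
      · exact h.2
    rw [chowRelation_eq, map_mul, map_pow, map_sum, Finset.sum_eq_zero, zero_pow hpos.ne', mul_zero]
    intro H _
    split_ifs with hT
    · obtain rfl := c.eq_of_T_le hT
      exact chainHom_X_eq_zero (fun h => hCT.ne (congrArg Subtype.val h).symm) (by omega)
    · exact map_zero _
  · have := rkElt_le_degree (S := S) c.rk_eq_one_of_lt_C (G := c.C j)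
    have := c.rk_C j
    omega
  · refine absurd (chainHom_chowRelation_rk_one ?_ c.rk_ne_zero S h) hne
    rintro H rfl
    omega

end FlagWithHyperplanes

/-! ### Dimensions in degrees one, two and three -/

namespace FlagWithHyperplanes

section Ranks

variable {M : Matroid α} {𝒢 : Set (Flat M)} (c : FlagWithHyperplanes 𝒢)

/-- The three flats of the flag. -/
def flag : Fin 3 → 𝒢 := ![c.A, c.B, c.T]

theorem flag_injective : Function.Injective c.flag := by
  have h1 := c.rk_B
  have h2 := c.rk_T
  have hAB : c.A ≠ c.B := fun h => by rw [h] at h1; omega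
  have hBT : c.B ≠ c.T := fun h => by rw [h] at h2; omega
  have hAT : c.A ≠ c.T := fun h => by rw [h] at h1; omega
  intro i j h
  fin_cases i <;> fin_cases j <;> simp_all [flag, eq_comm]

theorem flag_ne_C (i : Fin 3) (j : Fin 7) : c.flag i ≠ c.C j := by
  have h1 := c.rk_B
  have h2 := c.rk_T
  have h3 := c.rk_C j
  intro h
  have h4 := congrArg rkElt h
  fin_cases i
  all_goals
    simp only [flag, Fin.zero_eta, Matrix.cons_val_zero, Fin.mk_one, Matrix.cons_val_one,
      Fin.reduceFinMk, Matrix.cons_val] at h4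
    omega

theorem rk_flag_ne_one (i : Fin 3) : rkElt (c.flag i) ≠ 1 := by
  have h0 := c.rk_A
  have h1 := c.rk_B
  have h2 := c.rk_T
  fin_cases i
  all_goals
    simp only [flag, Fin.zero_eta, Matrix.cons_val_zero, Fin.mk_one, Matrix.cons_val_one,
      Fin.reduceFinMk, Matrix.cons_val]
    omega

theorem rk_C_ne_one (i : Fin 7) : rkElt (c.C i) ≠ 1 := by
  have h0 := c.rk_A
  have h1 := c.rk_B
  have h2 := c.rk_T
  have h3 := c.rk_C i
  omega

theorem flag_mem (i : Fin 3) : c.flag i ∈ ({c.A, c.B, c.T} : Set 𝒢) := by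
  fin_cases i <;> simp [flag]

end Ranks

variable [Finite α] {M : Matroid α} {𝒢 : Set (Flat M)} (c : FlagWithHyperplanes 𝒢)

include c

theorem ten_le_finrank : 10 ≤ Module.finrank ℚ (chowPiece 𝒢 1) := by
  classical
  have := Fintype.ofFinite 𝒢
  let b : Fin 3 ⊕ Fin 7 → 𝒢 := Sum.elim c.flag c.C
  have hb : Function.Injective b := c.flag_injective.sumElim c.C_injective c.flag_ne_C
  have := card_le_finrank_chowPiece (𝒢 := 𝒢) (fun k => Finsupp.single (b k) 1)
    (fun i j h => hb (Finsupp.single_left_injective one_ne_zero h)) (d := 1) (by norm_num)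
    (by simp) ?_ ?_
  · simpa using this
  · rintro (i | i) H hH <;> obtain rfl := Finset.mem_singleton.1 (Finsupp.support_single_subset hH)
    · exact c.rk_flag_ne_one i
    · exact c.rk_C_ne_one i
  · rintro (i | i)
    · refine ⟨_, c.isCompatible_flag, fun H hH => ?_⟩
      obtain rfl := Finset.mem_singleton.1 (Finsupp.support_single_subset hH)
      exact c.flag_mem i
    · refine ⟨_, c.isCompatible_hyperplane i, fun H hH => ?_⟩
      exact Finset.mem_singleton.1 (Finsupp.support_single_subset hH)

theorem seventeen_le_finrank : 17 ≤ Module.finrank ℚ (chowPiece 𝒢 3) := by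
  classical
  have := Fintype.ofFinite 𝒢
  let κ := {e : Fin 3 → Fin 4 // ∑ i, (e i : ℕ) = 3}
  let m : κ ⊕ Fin 7 → 𝒢 →₀ ℕ := Sum.elim
    (fun e => ∑ i, Finsupp.single (c.flag i) (e.1 i : ℕ)) (fun i => Finsupp.single (c.C i) 3)
  have hflag : ∀ (e : κ) i, m (Sum.inl e) (c.flag i) = e.1 i := by
    intro e i
    simp [m, Finsupp.finsetSum_apply, Finsupp.single_apply, c.flag_injective.eq_iff]
  have hC : ∀ (e : κ) i, m (Sum.inl e) (c.C i) = 0 := by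
    intro e i
    simp [m, Finsupp.finsetSum_apply, c.flag_ne_C]
  have hs : ∀ (e : κ), ∀ H ∈ (m (Sum.inl e)).support, ∃ i, H = c.flag i := by
    intro e H hH
    by_contra! hc
    refine Finsupp.mem_support_iff.1 hH ?_
    simp [m, Finsupp.finsetSum_apply, fun i => (hc i).symm]
  have hm : Function.Injective m := by
    rintro (e | i) (e' | j) h
    · refine congrArg Sum.inl (Subtype.ext (funext fun i => Fin.ext ?_))
      rw [← hflag, ← hflag, h]
    · have := DFunLike.congr_fun h (c.C j)
      rw [hC] at this
      simp [m] at this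
    · have := DFunLike.congr_fun h (c.C i)
      rw [hC] at this
      simp [m] at this
    · exact congrArg Sum.inr (c.C_injective (Finsupp.single_left_injective three_ne_zero h))
  have := card_le_finrank_chowPiece (𝒢 := 𝒢) m hm (d := 3) le_rfl ?_ ?_ ?_
  · have hκ : Fintype.card κ = 10 := by decide
    simpa [hκ] using this
  · rintro (e | i)
    · simpa [m] using e.2
    · simp [m]
  · rintro (e | i) H hH
    · obtain ⟨i, rfl⟩ := hs e H hH
      exact c.rk_flag_ne_one i
    · obtain rfl := Finset.mem_singleton.1 (Finsupp.support_single_subset hH)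
      exact c.rk_C_ne_one i
  · rintro (e | i)
    · refine ⟨_, c.isCompatible_flag, fun H hH => ?_⟩
      obtain ⟨i, rfl⟩ := hs e H hH
      exact c.flag_mem i
    · refine ⟨_, c.isCompatible_hyperplane i, fun H hH => ?_⟩
      exact Finset.mem_singleton.1 (Finsupp.support_single_subset hH)

omit c [Finite α] in
theorem mk_X_mul_mk_X {H K : 𝒢} (hHK : H ≠ K) {T : 𝒢} (h : relExponent {H, K} T = 0) :
    Ideal.Quotient.mkₐ ℚ (chowIdeal 𝒢) (X H) * Ideal.Quotient.mkₐ ℚ (chowIdeal 𝒢) (X K) = 0 := by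
  have h1 := chowRelation_mem {H, K} T
  have h2 : chowRelation 𝒢 {H, K} T = (∏ L ∈ {H, K}, X L) * _ ^ relExponent {H, K} T := rfl
  rw [h2, h, pow_zero, mul_one, Finset.prod_pair hHK] at h1
  rw [← map_mul]
  exact Ideal.Quotient.eq_zero_iff_mem.2 h1

/-- The join of the hyperplane `C i` with `H` has the rank of `T`, so the relation for `{C i, H}`
and `T` has exponent 0. -/
theorem mk_C_mul_mk {H : 𝒢} {i : Fin 7} (hT : H ≠ c.T) (hH : ¬ (H : Flat M) ≤ c.C i)
    (hHT : (H : Flat M) ≤ c.T) :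
    Ideal.Quotient.mkₐ ℚ (chowIdeal 𝒢) (X (c.C i)) *
      Ideal.Quotient.mkₐ ℚ (chowIdeal 𝒢) (X H) = 0 := by
  refine mk_X_mul_mk_X (T := c.T) (fun h => hH (h ▸ le_rfl)) (Nat.le_zero.1 ?_)
  refine relExponent_le ((c.C i : Flat M) ⊔ H) (fun L hL => ?_) ?_
  · have hne : (c.C i : Flat M) ≠ c.T := fun h => hH (h ▸ hHT)
    exact sup_le (hL _ (by simp) (lt_of_le_of_ne (c.C_le_T i) hne))
      (hL _ (by simp) (lt_of_le_of_ne hHT fun h => hT (Subtype.ext h)))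
  · have h1 : (c.C i : Flat M) < (c.C i : Flat M) ⊔ H := left_lt_sup.2 hH
    have h2 := rk_lt_of_lt h1
    have h3 := c.rk_C i
    simp only [rkElt] at *
    omega

/-- Here `S = {C i}` and `G = T`: the exponent is 1, and the sum over members above `T` is just
`x_T`. -/
theorem mk_C_mul_mk_T (i : Fin 7) :
    Ideal.Quotient.mkₐ ℚ (chowIdeal 𝒢) (X (c.C i)) *
      Ideal.Quotient.mkₐ ℚ (chowIdeal 𝒢) (X c.T) = 0 := by
  classical
  have := Fintype.ofFinite 𝒢
  have h3 := c.rk_C i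
  have hlt : (c.C i : Flat M) < c.T := lt_of_le_of_ne (c.C_le_T i) fun h => by
    have := congrArg (fun F : Flat M => rk M (F : Set α)) h
    simp only [rkElt] at *
    omega
  have h1 := chowRelation_mem {c.C i} c.T
  have h4 : relExponent {c.C i} c.T = 1 := by
    have h5 := relExponent_pos (S := {c.C i}) hlt (by simp)
    have h6 := relExponent_le (S := {c.C i}) (G := c.T) (n := 1) (c.C i)
      (fun L hL => hL _ (by simp) hlt) h3.ge
    omega
  rw [chowRelation_eq, h4, pow_one, Finset.prod_singleton, Finset.sum_eq_single c.T,
    if_pos le_rfl] at h1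
  · rw [← map_mul]
    exact Ideal.Quotient.eq_zero_iff_mem.2 h1
  · exact fun H _ hH => if_neg fun h => hH (c.eq_of_T_le h)
  · simp

/-- For `H` of rank one, the relation with `S = ∅` and `G = H` is linear and expresses `x_H` through
variables strictly above it, none of which has rank one. -/
theorem mk_X_mem_span (H : 𝒢) : Ideal.Quotient.mkₐ ℚ (chowIdeal 𝒢) (X H) ∈
    Submodule.span ℚ (Set.range fun k =>
      Ideal.Quotient.mkₐ ℚ (chowIdeal 𝒢) (X (Sum.elim c.flag c.C k))) := by
  classical
  have := Fintype.ofFinite 𝒢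
  have key : ∀ K : 𝒢, rkElt K ≠ 1 → Ideal.Quotient.mkₐ ℚ (chowIdeal 𝒢) (X K) ∈
    Submodule.span ℚ (Set.range fun k =>
      Ideal.Quotient.mkₐ ℚ (chowIdeal 𝒢) (X (Sum.elim c.flag c.C k))) := by
    intro K hK
    apply Submodule.subset_span
    rcases c.eq_or K with rfl | rfl | rfl | ⟨i, rfl⟩ | h
    · exact ⟨Sum.inl 0, rfl⟩
    · exact ⟨Sum.inl 1, rfl⟩
    · exact ⟨Sum.inl 2, rfl⟩
    · exact ⟨Sum.inr i, rfl⟩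
    · exact absurd h hK
  by_cases hH : rkElt H = 1
  swap
  · exact key H hH
  have h1 := chowRelation_mem ∅ H
  have h2 : relExponent ∅ H = 1 := by
    have h3 := rkElt_le_degree (S := ∅) (G := H) (by simp)
    simp only [Finset.card_empty] at h3
    have h4 : relExponent ∅ H ≤ rkElt H := Nat.sub_le _ _
    omega
  rw [chowRelation_eq, h2, pow_one, Finset.prod_empty, one_mul,
    ← Finset.add_sum_erase _ _ (Finset.mem_univ H), if_pos le_rfl] at h1
  have h3 := Ideal.Quotient.eq_zero_iff_mem.2 h1
  rw [map_add, map_sum] at h3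
  change Ideal.Quotient.mk _ _ ∈ _
  rw [eq_neg_of_add_eq_zero_left h3]
  refine Submodule.neg_mem _ (Submodule.sum_mem _ fun K hK => ?_)
  split_ifs with hle
  · refine key K fun hK1 => (Finset.mem_erase.1 hK).1 ?_
    exact (Subtype.ext (eq_of_le_of_rk_le hle (hK1.trans hH.symm).le)).symm
  · rw [map_zero]
    exact Submodule.zero_mem _

/-- Among products of two spanning variables, only the six quadratic monomials in the flag and the
seven squares `x_{C i} ^ 2` can be nonzero. -/
theorem finrank_le_thirteen : Module.finrank ℚ (chowPiece 𝒢 2) ≤ 13 := by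
  classical
  let x : 𝒢 → ChowRing 𝒢 := fun H => Ideal.Quotient.mkₐ ℚ (chowIdeal 𝒢) (X H)
  let v : Sym2 (Fin 3) ⊕ Fin 7 → ChowRing 𝒢 := Sum.elim
    (Sym2.lift ⟨fun i j => x (c.flag i) * x (c.flag j), fun i j => mul_comm _ _⟩)
    (fun i => x (c.C i) * x (c.C i))
  let U := Submodule.span ℚ (Set.range fun k => x (Sum.elim c.flag c.C k))
  have hCf : ∀ i j, x (c.C i) * x (c.flag j) = 0 := by
    intro i j
    have h1 := c.rk_B
    have h2 := c.rk_T
    fin_cases j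
    · exact c.mk_C_mul_mk (H := c.A) (fun h => by rw [h] at h1; omega) (c.not_A_le_C i)
        (c.A_le_B.trans c.B_le_T)
    · exact c.mk_C_mul_mk (H := c.B) (fun h => by rw [h] at h2; omega) (c.not_B_le_C i) c.B_le_T
    · exact c.mk_C_mul_mk_T i
  have hCC : ∀ i j, i ≠ j → x (c.C i) * x (c.C j) = 0 := by
    intro i j hij
    have h1 := c.rk_C i
    have h2 := c.rk_C j
    refine c.mk_C_mul_mk (fun h => by rw [h] at h2; omega) (fun h => hij ?_) (c.C_le_T j)
    refine (c.C_injective (Subtype.ext (eq_of_le_of_rk_le h ?_))).symm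
    simp only [rkElt] at *
    omega
  have hle : chowPiece 𝒢 2 ≤ Submodule.span ℚ (Set.range v) := by
    have h1 : (homogeneousSubmodule 𝒢 ℚ 1).map
        (Ideal.Quotient.mkₐ ℚ (chowIdeal 𝒢)).toLinearMap ≤ U := by
      rw [homogeneousSubmodule_one_eq_span_X, Submodule.map_span, Submodule.span_le]
      rintro _ ⟨_, ⟨H, rfl⟩, rfl⟩
      exact c.mk_X_mem_span H
    rw [chowPiece, ← homogeneousSubmodule_one_pow, Submodule.map_pow, pow_two]
    refine (mul_le_mul' h1 h1).trans ?_
    rw [Submodule.span_mul_span, Submodule.span_le]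
    rintro _ ⟨_, ⟨i | i, rfl⟩, _, ⟨j | j, rfl⟩, rfl⟩
    · exact Submodule.subset_span ⟨Sum.inl s(i, j), rfl⟩
    · simp [mul_comm (x (c.flag i)), hCf]
    · simp [hCf]
    · by_cases hij : i = j
      · subst hij
        exact Submodule.subset_span ⟨Sum.inr i, rfl⟩
      · simp [hCC i j hij]
  have := FiniteDimensional.span_of_finite ℚ (Set.finite_range v)
  refine (Submodule.finrank_mono hle).trans ((finrank_range_le_card v).trans ?_)
  rw [Fintype.card_sum, Sym2.card]
  decide

theorem not_hasLogConcaveCoeffs : ¬ HasLogConcaveCoeffs (chowPolynomial 𝒢) := by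
  intro h
  have h1 := h 1
  simp only [chowPolynomial, PowerSeries.coeff_mk, Nat.reduceAdd] at h1
  have h2 := Nat.mul_le_mul c.ten_le_finrank c.seventeen_le_finrank
  have h3 := Nat.pow_le_pow_left c.finrank_le_thirteen 2
  omega

end FlagWithHyperplanes

/-! ### Families of flats realising the configuration -/

section FlagFamily

variable {M : Matroid α}

/-- The flats among `A`, `B`, the ground set, the sets `C i`, and the singletons. -/
def flagFamily (M : Matroid α) (A B : Set α) (C : Fin 7 → Set α) : Set (Flat M) :=
  {F | (F : Set α) = A ∨ (F : Set α) = B ∨ (F : Set α) = M.E ∨ (∃ i, (F : Set α) = C i) ∨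
    ∃ e, (F : Set α) = {e}}

theorem factors_pairwiseDisjoint {𝒢 : Set (Flat M)} {F : Flat M}
    (h : ∀ G ∈ 𝒢, ∀ H ∈ 𝒢, G ≤ F → H ≤ F → G ≤ H ∨ H ≤ G ∨ Disjoint (G : Set α) H) :
    (factors 𝒢 F).PairwiseDisjoint (fun G => (G : Set α)) := by
  intro G hG H hH hne
  rcases h G hG.1.1 H hH.1.1 hG.1.2 hH.1.2 with h | h | h
  · exact absurd (le_antisymm h (hG.2 hH.1 h)) hne
  · exact absurd (le_antisymm (hH.2 hG.1 h) h) hne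
  · exact h

variable [Finite α]

/-- A flat outside the family contains neither the ground set nor any `C i`. The members below it
come from `A ⊆ B` and singletons, which are pairwise nested or disjoint, so distinct factors are
disjoint. -/
theorem isBuildingSet_flagFamily {A B : Set α} {C : Fin 7 → Set α} (hA : A.Nonempty)
    (hAB : A ⊆ B) (hE : M.E.Nonempty) (hC : ∀ i, (C i).Nonempty)
    (hs : ∀ e ∈ M.E, M.IsFlat {e})
    (hCF : ∀ F : Flat M, ∀ i, C i ⊆ F → F ∈ flagFamily M A B C)
    (hI : ∀ F : Flat M, F ∉ flagFamily M A B C → ∃ I, M.Indep I ∧ I ⊆ F ∧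
      ∀ G ∈ factors (flagFamily M A B C) F, (G : Set α) ⊆ M.closure (I ∩ G)) :
    IsBuildingSet (flagFamily M A B C) := by
  refine isBuildingSet_of_indep ?_ ?_ fun F hF => ⟨factors_pairwiseDisjoint ?_, hI F hF⟩
  · rintro G (h | h | h | ⟨i, h⟩ | ⟨e, h⟩) <;> rw [h]
    exacts [hA, hA.mono hAB, hE, hC i, Set.singleton_nonempty e]
  · intro F e he
    exact ⟨⟨{e}, hs e (F.2.subset_ground he)⟩, Or.inr (Or.inr (Or.inr (Or.inr ⟨e, rfl⟩))),
      Set.singleton_subset_iff.2 he, rfl⟩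
  · have key : ∀ G ∈ flagFamily M A B C, G ≤ F →
        (G : Set α) = A ∨ (G : Set α) = B ∨ ∃ e, (G : Set α) = {e} := by
      rintro G (h | h | h | ⟨i, h⟩ | h) hGF
      · exact Or.inl h
      · exact Or.inr (Or.inl h)
      · exact absurd (Or.inr (Or.inr (Or.inl
          (F.2.subset_ground.antisymm (h ▸ Subtype.coe_le_coe.2 hGF))))) hF
      · exact absurd (hCF F i (h ▸ Subtype.coe_le_coe.2 hGF)) hF
      · exact Or.inr (Or.inr h)
    have hsing : ∀ G H : Flat M, (∃ e, (G : Set α) = {e}) →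
        G ≤ H ∨ Disjoint (G : Set α) H := by
      rintro G H ⟨e, he⟩
      by_cases heH : e ∈ (H : Set α)
      · exact Or.inl (Subtype.coe_le_coe.1 (he ▸ Set.singleton_subset_iff.2 heH))
      · exact Or.inr (he ▸ Set.disjoint_singleton_left.2 heH)
    intro G hG H hH hGF hHF
    rw [← Subtype.coe_le_coe, ← Subtype.coe_le_coe]
    rcases key G hG hGF with hG | hG | hG
    · rcases key H hH hHF with hH | hH | hH
      · exact Or.inl (hG.trans hH.symm).subset
      · exact Or.inl (by rw [hG, hH]; exact hAB)
      · rcases hsing H G hH with h | h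
        exacts [Or.inr (Or.inl h), Or.inr (Or.inr h.symm)]
    · rcases key H hH hHF with hH | hH | hH
      · exact Or.inr (Or.inl (by rw [hG, hH]; exact hAB))
      · exact Or.inl (hG.trans hH.symm).subset
      · rcases hsing H G hH with h | h
        exacts [Or.inr (Or.inl h), Or.inr (Or.inr h.symm)]
    · rcases hsing G H hG with h | h
      exacts [Or.inl h, Or.inr (Or.inr h)]

theorem not_hasLogConcaveCoeffs_flagFamily [M.Loopless] {A B : Set α} {C : Fin 7 → Set α}
    (hA : M.IsFlat A) (hB : M.IsFlat B) (hC : ∀ i, M.IsFlat (C i)) (hAB : A ⊆ B)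
    (hAC : ∀ i, ¬ A ⊆ C i) (hinj : Function.Injective C) (rA : 4 ≤ rk M A)
    (rB : rk M A + 3 ≤ rk M B) (rE : rk M B + 3 ≤ rk M M.E) (rC : ∀ i, rk M (C i) + 1 = rk M M.E) :
    ¬ HasLogConcaveCoeffs (chowPolynomial (flagFamily M A B C)) :=
  FlagWithHyperplanes.not_hasLogConcaveCoeffs
    { A := ⟨⟨A, hA⟩, Or.inl rfl⟩
      B := ⟨⟨B, hB⟩, Or.inr (Or.inl rfl)⟩
      T := ⟨⟨M.E, M.ground_isFlat⟩, Or.inr (Or.inr (Or.inl rfl))⟩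
      C := fun i => ⟨⟨C i, hC i⟩, Or.inr (Or.inr (Or.inr (Or.inl ⟨i, rfl⟩)))⟩
      A_le_B := hAB
      B_le_T := hB.subset_ground
      C_le_T := fun i => (hC i).subset_ground
      not_A_le_C := hAC
      C_injective := fun i j h => hinj (congrArg Subtype.val (congrArg Subtype.val h))
      rk_A := rA
      rk_B := rB
      rk_T := rE
      rk_C := rC
      eq_or := by
        rintro ⟨⟨H, hH⟩, h | h | h | ⟨i, h⟩ | ⟨e, h⟩⟩
        · exact Or.inl (Subtype.ext (Subtype.ext h))
        · exact Or.inr (Or.inl (Subtype.ext (Subtype.ext h)))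
        · exact Or.inr (Or.inr (Or.inl (Subtype.ext (Subtype.ext h))))
        · exact Or.inr (Or.inr (Or.inr (Or.inl ⟨i, Subtype.ext (Subtype.ext h)⟩)))
        · refine Or.inr (Or.inr (Or.inr (Or.inr ?_)))
          change rk M H = 1
          obtain rfl : H = {e} := h
          rw [rk, Matroid.eRk_singleton_eq (hH.subset_ground rfl), ENat.toNat_one] }

end FlagFamily

/-! ### Boolean matroids -/

section Boolean

theorem isFlat_boolean {n : ℕ} (X : Set (Fin n)) : (boolean n).IsFlat X := by
  rw [Matroid.isFlat_iff_closure_eq]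
  simp [boolean]

theorem rk_boolean {n : ℕ} (X : Set (Fin n)) : rk (boolean n) X = X.ncard :=
  rk_indep (by simp [boolean])

instance {n : ℕ} : (boolean n).Loopless := by
  rw [Matroid.loopless_iff_forall_isNonloop]
  intro e _
  rw [← Matroid.indep_singleton]
  simp [boolean]

theorem ncard_setOf_lt {n k : ℕ} (h : k ≤ n) : {x : Fin n | (x : ℕ) < k}.ncard = k := by
  rw [← Nat.card_coe_set_eq, Nat.card_eq_fintype_card, Fintype.card_subtype]
  simp [Fin.card_filter_val_lt, h]

theorem exists_boolean {n : ℕ} (hn : 13 ≤ n) : ∃ 𝒢 : Set (Flat (boolean n)),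
    IsBuildingSet 𝒢 ∧ ¬ HasLogConcaveCoeffs (chowPolynomial 𝒢) := by
  -- `A` has seven points, so that removing each from the ground set gives seven hyperplanes not
  -- containing `A`; the jumps are 7, 3 and `n - 10 ≥ 3`.
  let A : Set (Fin n) := {x | (x : ℕ) < 7}
  let B : Set (Fin n) := {x | (x : ℕ) < 10}
  let C : Fin 7 → Set (Fin n) := fun i => {Fin.castLE (by omega) i}ᶜ
  have hAB : A ⊆ B := fun x (hx : (x : ℕ) < 7) => show (x : ℕ) < 10 by omega
  have hA : A.ncard = 7 := ncard_setOf_lt (by omega)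
  have hB : B.ncard = 10 := ncard_setOf_lt (by omega)
  have hE : (boolean n).E = Set.univ := rfl
  have hEc : (Set.univ : Set (Fin n)).ncard = n := by simp
  have hCc : ∀ i, (C i).ncard + 1 = n := by
    intro i
    have := Set.ncard_add_ncard_compl {Fin.castLE (show 7 ≤ n by omega) i}
    rw [Set.ncard_singleton, Nat.card_fin] at this
    exact (add_comm _ _).trans this
  refine ⟨flagFamily (boolean n) A B C, isBuildingSet_flagFamily ?_ hAB ?_ ?_
    (fun e _ => isFlat_boolean _) ?_ ?_, not_hasLogConcaveCoeffs_flagFamily (isFlat_boolean _)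
    (isFlat_boolean _) (fun i => isFlat_boolean _) hAB ?_ ?_ ?_ ?_ ?_ ?_⟩
  · exact Set.nonempty_of_ncard_ne_zero (by omega)
  · exact Set.nonempty_of_ncard_ne_zero (by rw [hE]; omega)
  · exact fun i => Set.nonempty_of_ncard_ne_zero (by have := hCc i; omega)
  · intro F i hF
    by_cases hi : Fin.castLE (by omega) i ∈ (F : Set (Fin n))
    · refine Or.inr (Or.inr (Or.inl (Set.eq_univ_of_forall fun x => ?_)))
      by_cases hx : x = Fin.castLE (by omega) i
      · exact hx ▸ hi
      · exact hF hx
    · refine Or.inr (Or.inr (Or.inr (Or.inl ⟨i, Set.Subset.antisymm (fun x hx hxi => hi ?_) hF⟩)))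
      exact (show x = _ from hxi) ▸ hx
  · refine fun F _ => ⟨F, by simp [boolean], subset_rfl, fun G hG => ?_⟩
    rw [Set.inter_eq_right.2 (Subtype.coe_le_coe.2 hG.1.2)]
    exact (isFlat_boolean _).closure.symm.subset
  · exact fun i h => h (show (Fin.castLE (show 7 ≤ n by omega) i : ℕ) < 7 from i.2) rfl
  · intro i j h
    simpa [C] using h
  all_goals simp only [rk_boolean, hE]
  · omega
  · omega
  · omega
  · intro i
    rw [hEc]
    exact hCc i

end Boolean

/-! ### Recognising flats and closures by rank -/

section RankCriteria

variable {M : Matroid α}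

theorem rk_le_of_forall_indep {X : Set α} {n : ℕ} (hX : X ⊆ M.E)
    (h : ∀ I ⊆ X, M.Indep I → I.ncard ≤ n) : rk M X ≤ n := by
  obtain ⟨I, hI⟩ := M.exists_isBasis X
  rw [rk, hI.eRk_eq_encard]
  exact h I hI.subset hI.indep

variable [Finite α]

theorem subset_closure_of_rk_le {X J : Set α} (hX : X ⊆ M.E) (hJ : M.Indep J) (hJX : J ⊆ X)
    (h : rk M X ≤ J.ncard) : X ⊆ M.closure J := by
  have h1 : (⟨M.closure J, M.isFlat_closure _⟩ : Flat M) = ⟨M.closure X, M.isFlat_closure _⟩ :=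
    eq_of_le_of_rk_le (M.closure_subset_closure hJX) (by simpa [rk_closure, rk_indep hJ] using h)
  have h2 : M.closure J = M.closure X := congrArg Subtype.val h1
  exact h2 ▸ M.subset_closure X

theorem subset_flat_of_rk_le {X J : Set α} {F : Flat M} (hX : X ⊆ M.E) (hJ : M.Indep J)
    (hJX : J ⊆ X) (h : rk M X ≤ J.ncard) (hJF : J ⊆ F) : X ⊆ F :=
  (subset_closure_of_rk_le hX hJ hJX h).trans
    ((M.closure_subset_closure hJF).trans F.2.closure.subset)

/-- An element of the closure outside `X` would extend `J` to an independent set larger than `rk X`.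
-/
theorem isFlat_of_forall_insert {X J : Set α} (hX : X ⊆ M.E) (hJX : J ⊆ X)
    (h : rk M X ≤ J.ncard) (hins : ∀ e ∈ M.E, e ∉ X → M.Indep (insert e J)) : M.IsFlat X := by
  rw [Matroid.isFlat_iff_closure_eq]
  refine Set.Subset.antisymm (fun e he => ?_) (M.subset_closure X)
  by_contra heX
  have hI := hins e (Matroid.mem_ground_of_mem_closure he) heX
  have h1 : insert e J ⊆ M.closure X := Set.insert_subset he (hJX.trans (M.subset_closure X))
  have h2 := ncard_le_rk hI h1
  rw [Set.ncard_insert_of_notMem fun h => heX (hJX h), rk_closure] at h2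
  omega

end RankCriteria

/-! ### A matroid whose minimal building set has the required form -/

namespace Example

/-- The ground set of the example: thirteen elements and seven blocks of ten elements. -/
abbrev Ground : Type := Fin 13 ⊕ Fin 7 × Fin 10

/-- A circuit of rank `4`. -/
def A : Set Ground := {x | ∃ i : Fin 13, (i : ℕ) < 5 ∧ x = Sum.inl i}

/-- A cyclic flat of rank `7`. -/
def B : Set Ground := Set.range Sum.inl

/-- The circuit-hyperplanes. -/
def C (i : Fin 7) : Set Ground := {x | ∃ j, x = Sum.inr (i, j)}

theorem A_subset_B : A ⊆ B := by
  rintro _ ⟨i, -, rfl⟩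
  exact ⟨i, rfl⟩

theorem disjoint_B_C (i : Fin 7) : Disjoint B (C i) := by
  rw [Set.disjoint_left]
  rintro _ ⟨i, rfl⟩ ⟨j, h⟩
  cases h

theorem eq_of_mem_C {i j : Fin 7} {x : Ground} (hi : x ∈ C i) (hj : x ∈ C j) : i = j := by
  obtain ⟨a, rfl⟩ := hi
  obtain ⟨b, h⟩ := hj
  simp only [Sum.inr.injEq, Prod.mk.injEq] at h
  exact h.1

theorem ncard_A : A.ncard = 5 := by
  have : A = Sum.inl '' {x : Fin 13 | (x : ℕ) < 5} := by
    ext x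
    simp [A, eq_comm]
  rw [this, Set.ncard_image_of_injective _ Sum.inl_injective, ncard_setOf_lt (by norm_num)]

theorem ncard_B : B.ncard = 13 := by
  rw [B, ← Set.image_univ, Set.ncard_image_of_injective _ Sum.inl_injective, Set.ncard_univ,
    Nat.card_fin]

theorem ncard_C (i : Fin 7) : (C i).ncard = 10 := by
  have : C i = (fun j => Sum.inr (i, j)) '' Set.univ := by
    ext x
    simp [C, eq_comm]
  rw [this, Set.ncard_image_of_injective, Set.ncard_univ, Nat.card_fin]
  intro j k h
  simpa using h

theorem ncard_B_sdiff_A : (B \ A).ncard = 8 := by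
  rw [Set.ncard_sdiff A_subset_B, ncard_A, ncard_B]

/-- Independence in the nested matroid with cyclic flats `A`, `B` and the ground set. -/
def NestedIndep (I : Set Ground) : Prop :=
  (I ∩ A).ncard ≤ 4 ∧ (I ∩ B).ncard ≤ 7 ∧ I.ncard ≤ 10

theorem NestedIndep.subset {I J : Set Ground} (hJ : NestedIndep J) (h : I ⊆ J) : NestedIndep I :=
  ⟨(Set.ncard_le_ncard (Set.inter_subset_inter_left _ h)).trans hJ.1,
    (Set.ncard_le_ncard (Set.inter_subset_inter_left _ h)).trans hJ.2.1,
    (Set.ncard_le_ncard h).trans hJ.2.2⟩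

theorem ncard_insert_inter_le (e : Ground) (I X : Set Ground) :
    (insert e I ∩ X).ncard ≤ (I ∩ X).ncard + 1 :=
  (Set.ncard_le_ncard (fun x hx => hx.1.elim (fun h => Or.inl h) fun h => Or.inr ⟨h, hx.2⟩)).trans
    (Set.ncard_insert_le e _)

theorem exists_mem_notMem_of_inter_eq {I J X : Set Ground} {n : ℕ} (hI : (I ∩ X).ncard = n)
    (hJ : (J ∩ X).ncard ≤ n) (h : I.ncard < J.ncard) : ∃ e ∈ J, e ∉ I ∧ e ∉ X := by
  have h1 := Set.ncard_inter_add_ncard_sdiff_eq_ncard I X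
  have h2 := Set.ncard_inter_add_ncard_sdiff_eq_ncard J X
  obtain ⟨e, he, he'⟩ := Set.exists_mem_notMem_of_ncard_lt_ncard
    (show (I \ X).ncard < (J \ X).ncard by omega)
  exact ⟨e, he.1, fun h => he' ⟨h, he.2⟩, he.2⟩

/-- Look at the largest tight constraint among `B` and `A`: `J` has more elements than `I` outside
that set, and adding one of them keeps it and anything inside it unchanged. The bound 10 follows
from `J`. -/
theorem NestedIndep.augment {I J : Set Ground} (hI : NestedIndep I) (hJ : NestedIndep J)
    (h : I.ncard < J.ncard) : ∃ e ∈ J, e ∉ I ∧ NestedIndep (insert e I) := by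
  obtain ⟨hIA, hIB, -⟩ := hI
  obtain ⟨hJA, hJB, hJE⟩ := hJ
  have key : ∀ e, (insert e I).ncard ≤ 10 := fun e => (Set.ncard_insert_le e I).trans (by omega)
  by_cases hB : (I ∩ B).ncard = 7
  · obtain ⟨e, heJ, heI, heB⟩ := exists_mem_notMem_of_inter_eq hB hJB h
    refine ⟨e, heJ, heI, ?_, ?_, key e⟩
    · rwa [Set.insert_inter_of_notMem fun h => heB (A_subset_B h)]
    · rwa [Set.insert_inter_of_notMem heB]
  have h1 : ∀ e, (insert e I ∩ B).ncard ≤ 7 := fun e =>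
    (ncard_insert_inter_le e I B).trans (by omega)
  by_cases hA : (I ∩ A).ncard = 4
  · obtain ⟨e, heJ, heI, heA⟩ := exists_mem_notMem_of_inter_eq hA hJA h
    exact ⟨e, heJ, heI, by rwa [Set.insert_inter_of_notMem heA], h1 e, key e⟩
  · obtain ⟨e, heJ, heI⟩ := Set.exists_mem_notMem_of_ncard_lt_ncard h
    exact ⟨e, heJ, heI, (ncard_insert_inter_le e I A).trans (by omega), h1 e, key e⟩

/-- The independent sets of the nested matroid, except for the seven circuit-hyperplanes. -/
def Indep (I : Set Ground) : Prop := NestedIndep I ∧ ∀ i, I ≠ C i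

theorem Indep.subset {I J : Set Ground} (hJ : Indep J) (h : I ⊆ J) : Indep I := by
  refine ⟨hJ.1.subset h, ?_⟩
  rintro i rfl
  exact hJ.2 i (Set.eq_of_subset_of_ncard_le h (hJ.1.2.2.trans_eq (ncard_C i).symm)).symm

theorem ncard_inter_B_eq_zero {i : Fin 7} {I : Set Ground} (h : I ⊆ C i) : (I ∩ B).ncard = 0 := by
  rw [Set.ncard_eq_zero, ← Set.disjoint_iff_inter_eq_empty]
  exact ((disjoint_B_C i).mono_right h).symm

theorem ncard_inter_A_le (I : Set Ground) : (I ∩ A).ncard ≤ (I ∩ B).ncard :=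
  Set.ncard_le_ncard (Set.inter_subset_inter_right _ A_subset_B)

/-- If the nested augmentation produces `C i`, then `I` is nine elements of that block and misses
`B`. Any element of `J` outside `C i` can be added instead, and the result lies in no single block.
-/
theorem Indep.augment {I J : Set Ground} (hI : Indep I) (hJ : Indep J)
    (h : I.ncard < J.ncard) : ∃ e ∈ J, e ∉ I ∧ Indep (insert e I) := by
  obtain ⟨e, heJ, heI, he⟩ := hI.1.augment hJ.1 h
  by_cases hC : ∀ i, insert e I ≠ C i
  · exact ⟨e, heJ, heI, he, hC⟩
  push Not at hC
  obtain ⟨i, hi⟩ := hC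
  have hIC : I ⊆ C i := hi ▸ Set.subset_insert e I
  have hcard : I.ncard + 1 = 10 := by
    rw [← Set.ncard_insert_of_notMem heI, hi, ncard_C]
  have hJC : ¬ J ⊆ C i := fun hs => hJ.2 i
    (Set.eq_of_subset_of_ncard_le hs (by rw [ncard_C]; omega))
  obtain ⟨f, hfJ, hfC⟩ := Set.not_subset.1 hJC
  have hfI : f ∉ I := fun h => hfC (hIC h)
  have h0 := ncard_inter_B_eq_zero hIC
  have h1 := ncard_insert_inter_le f I B
  have h2 := ncard_inter_A_le (insert f I)
  refine ⟨f, hfJ, hfI, ⟨by omega, by omega, (Set.ncard_insert_le f I).trans (by omega)⟩, ?_⟩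
  intro j hj
  obtain ⟨x, hx⟩ : I.Nonempty := Set.nonempty_of_ncard_ne_zero (by omega)
  obtain rfl := eq_of_mem_C (hIC hx) (hj ▸ Set.mem_insert_of_mem f hx)
  exact hfC (hj ▸ Set.mem_insert f I)

theorem indep_of_ncard_le_four {I : Set Ground} (h : I.ncard ≤ 4) : Indep I := by
  have h1 := Set.ncard_le_ncard (Set.inter_subset_left (s := I) (t := A))
  have h2 := Set.ncard_le_ncard (Set.inter_subset_left (s := I) (t := B))
  refine ⟨⟨by omega, by omega, by omega⟩, ?_⟩
  rintro i rfl
  rw [ncard_C] at h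
  omega

/-- The matroid with cyclic flats `∅`, `A`, `B`, the ground set, and the sets `C i`, of ranks
`0`, `4`, `7`, `10` and `9`. -/
def matroid : Matroid Ground :=
  (IndepMatroid.ofFinite (E := Set.univ) Set.finite_univ Indep (indep_of_ncard_le_four (by simp))
    (fun _ _ hJ h => hJ.subset h) (fun _ _ hI hJ h => hI.augment hJ h)
    (fun _ _ => Set.subset_univ _)).matroid

theorem indep_iff {I : Set Ground} : matroid.Indep I ↔ Indep I := by
  simp [matroid]

theorem subset_ground (X : Set Ground) : X ⊆ matroid.E := Set.subset_univ X

instance : matroid.Loopless := by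
  rw [Matroid.loopless_iff_forall_isNonloop]
  intro e _
  rw [← Matroid.indep_singleton, indep_iff]
  exact indep_of_ncard_le_four (by simp)

theorem isFlat_singleton (e : Ground) : matroid.IsFlat {e} := by
  refine isFlat_of_forall_insert (subset_ground _) subset_rfl (rk_le_ncard _ _) fun f _ _ => ?_
  rw [indep_iff]
  refine indep_of_ncard_le_four ((Set.ncard_insert_le _ _).trans ?_)
  rw [Set.ncard_singleton]
  norm_num

theorem indep_of_subset_C {i : Fin 7} {I : Set Ground} (h : I ⊆ C i) (hI : I.ncard ≤ 9) :
    Indep I := by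
  have h1 := ncard_inter_B_eq_zero h
  have h2 := ncard_inter_A_le I
  refine ⟨⟨by omega, by omega, by omega⟩, ?_⟩
  rintro j rfl
  rw [ncard_C] at hI
  omega

theorem ncard_inter_A_eq_zero {I : Set Ground} (h : I ⊆ B \ A) : (I ∩ A).ncard = 0 := by
  rw [Set.ncard_eq_zero, ← Set.disjoint_iff_inter_eq_empty]
  exact Set.disjoint_left.2 fun x hx => (h hx).2

theorem indep_insert_of_subset_B_sdiff_A {I : Set Ground} {e : Ground} (h : I ⊆ B \ A)
    (hI : I.ncard ≤ 7) (he : I.ncard ≤ 6 ∨ e ∉ B) : Indep (insert e I) := by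
  have h1 := ncard_inter_A_eq_zero h
  have h2 := ncard_insert_inter_le e I A
  have h3 := Set.ncard_insert_le e I
  refine ⟨⟨by omega, ?_, by omega⟩, ?_⟩
  · rcases he with he | he
    · exact (Set.ncard_le_ncard Set.inter_subset_left).trans (by omega)
    · rw [Set.insert_inter_of_notMem he]
      exact (Set.ncard_le_ncard Set.inter_subset_left).trans hI
  · intro i hi
    rw [hi, ncard_C] at h3
    omega

theorem rk_A_le : rk matroid A ≤ 4 :=
  rk_le_of_forall_indep (subset_ground _) fun I hI h => by
    simpa [Set.inter_eq_left.2 hI] using (indep_iff.1 h).1.1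

theorem rk_B_le : rk matroid B ≤ 7 :=
  rk_le_of_forall_indep (subset_ground _) fun I hI h => by
    simpa [Set.inter_eq_left.2 hI] using (indep_iff.1 h).1.2.1

theorem rk_ground_le : rk matroid matroid.E ≤ 10 :=
  rk_le_of_forall_indep (subset_ground _) fun _ _ h => (indep_iff.1 h).1.2.2

theorem rk_C_le (i : Fin 7) : rk matroid (C i) ≤ 9 :=
  rk_le_of_forall_indep (subset_ground _) fun I hI h => by
    by_contra! h9
    exact (indep_iff.1 h).2 i (Set.eq_of_subset_of_ncard_le hI (by rw [ncard_C]; omega))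

theorem exists_subset_A : ∃ J ⊆ A, J.ncard = 4 ∧ Indep J := by
  obtain ⟨J, hJ, hc⟩ := Set.exists_subset_card_eq (s := A) (n := 4) (by rw [ncard_A]; norm_num)
  exact ⟨J, hJ, hc, indep_of_ncard_le_four hc.le⟩

theorem exists_subset_B_sdiff_A : ∃ J ⊆ B \ A, J.ncard = 7 ∧ Indep J := by
  obtain ⟨J, hJ, hc⟩ := Set.exists_subset_card_eq (s := B \ A) (n := 7)
    (by rw [ncard_B_sdiff_A]; norm_num)
  exact ⟨J, hJ, hc, (indep_insert_of_subset_B_sdiff_A (e := Sum.inr 0) hJ hc.le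
    (Or.inr (by simp [B]))).subset (Set.subset_insert _ _)⟩

theorem exists_subset_C (i : Fin 7) : ∃ J ⊆ C i, J.ncard = 9 ∧ Indep J := by
  obtain ⟨J, hJ, hc⟩ := Set.exists_subset_card_eq (s := C i) (n := 9)
    (by rw [ncard_C]; norm_num)
  exact ⟨J, hJ, hc, indep_of_subset_C hJ hc.le⟩

theorem ncard_sdiff_pair_add_two (X : Set Ground) (e f : Ground) :
    X.ncard ≤ (X \ {e, f}).ncard + 2 := by
  have h1 := Set.ncard_le_ncard_sdiff_add_ncard X {e, f}
  have h2 : ({e, f} : Set Ground).ncard ≤ 2 := by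
    have := Set.ncard_insert_le e {f}
    rwa [Set.ncard_singleton] at this
  omega

theorem exists_subset_avoiding {X : Set Ground} {n : ℕ} (h : n + 2 ≤ X.ncard) (e f : Ground) :
    ∃ J ⊆ X, e ∉ J ∧ f ∉ J ∧ J.ncard = n := by
  obtain ⟨J, hJ, hc⟩ := Set.exists_subset_card_eq (s := X \ {e, f}) (n := n)
    (by have := ncard_sdiff_pair_add_two X e f; omega)
  exact ⟨J, hJ.trans Set.sdiff_subset, fun h => (hJ h).2 (by simp), fun h => (hJ h).2 (by simp), hc⟩

/-- Any two elements avoid some independent set of size `9` to which each of them can be added. -/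
theorem exists_avoiding (e f : Ground) : ∃ J : Set Ground, e ∉ J ∧ f ∉ J ∧ J.ncard = 9 ∧
    ∀ x, Indep (insert x J) := by
  -- Taking points from two blocks prevents any one-element extension from being a `C i`, and both
  -- blocks miss `B`, so the nested constraints are slack.
  obtain ⟨J₀, h0, he0, hf0, hc0⟩ := exists_subset_avoiding (X := C 0) (n := 5)
    (by rw [ncard_C]; norm_num) e f
  obtain ⟨J₁, h1, he1, hf1, hc1⟩ := exists_subset_avoiding (X := C 1) (n := 4)
    (by rw [ncard_C]; norm_num) e f
  have hd : Disjoint J₀ J₁ := Set.disjoint_left.2 fun x hx hx' =>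
    absurd (eq_of_mem_C (h0 hx) (h1 hx')) (by decide)
  have hc : (J₀ ∪ J₁).ncard = 9 := by rw [Set.ncard_union_eq hd, hc0, hc1]
  refine ⟨J₀ ∪ J₁, by simp [he0, he1], by simp [hf0, hf1], hc, fun x => ?_⟩
  have h2 := ncard_insert_inter_le x (J₀ ∪ J₁) B
  have h3 := ncard_inter_A_le (insert x (J₀ ∪ J₁))
  have h4 : ((J₀ ∪ J₁) ∩ B).ncard = 0 := by
    have h5 := Set.ncard_union_le (J₀ ∩ B) (J₁ ∩ B)
    rw [ncard_inter_B_eq_zero h0, ncard_inter_B_eq_zero h1] at h5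
    rw [Set.union_inter_distrib_right]
    omega
  refine ⟨⟨by omega, by omega, (Set.ncard_insert_le _ _).trans (by omega)⟩, fun i hi => ?_⟩
  obtain ⟨x₀, hx0⟩ : J₀.Nonempty := Set.nonempty_of_ncard_ne_zero (by omega)
  obtain ⟨x₁, hx1⟩ : J₁.Nonempty := Set.nonempty_of_ncard_ne_zero (by omega)
  have h5 : x₀ ∈ C i := hi ▸ Set.mem_insert_of_mem x (Or.inl hx0)
  have h6 : x₁ ∈ C i := hi ▸ Set.mem_insert_of_mem x (Or.inr hx1)
  exact absurd ((eq_of_mem_C (h0 hx0) h5).trans (eq_of_mem_C h6 (h1 hx1))) (by decide)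

theorem rk_A : rk matroid A = 4 := by
  obtain ⟨J, hJ, hc, hI⟩ := exists_subset_A
  exact le_antisymm rk_A_le (hc.symm.le.trans (ncard_le_rk (indep_iff.2 hI) hJ))

theorem rk_B : rk matroid B = 7 := by
  obtain ⟨J, hJ, hc, hI⟩ := exists_subset_B_sdiff_A
  exact le_antisymm rk_B_le
    (hc.symm.le.trans (ncard_le_rk (indep_iff.2 hI) (hJ.trans Set.sdiff_subset)))

theorem rk_C (i : Fin 7) : rk matroid (C i) = 9 := by
  obtain ⟨J, hJ, hc, hI⟩ := exists_subset_C i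
  exact le_antisymm (rk_C_le i) (hc.symm.le.trans (ncard_le_rk (indep_iff.2 hI) hJ))

theorem rk_ground : rk matroid matroid.E = 10 := by
  refine le_antisymm rk_ground_le ?_
  obtain ⟨J, h, -, hc, hI⟩ := exists_avoiding (Sum.inl 0) (Sum.inl 0)
  have := ncard_le_rk (indep_iff.2 (hI (Sum.inl 0))) (subset_ground _)
  rwa [Set.ncard_insert_of_notMem h, hc] at this

theorem isFlat_A : matroid.IsFlat A := by
  obtain ⟨J, hJ, hc, hI⟩ := exists_subset_A
  refine isFlat_of_forall_insert (subset_ground _) hJ (hc ▸ rk_A_le) fun e _ he => ?_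
  rw [indep_iff]
  have h1 := Set.ncard_insert_le e J
  refine ⟨⟨?_, (Set.ncard_le_ncard Set.inter_subset_left).trans (by omega), by omega⟩, ?_⟩
  · rw [Set.insert_inter_of_notMem he]
    exact (Set.ncard_le_ncard Set.inter_subset_left).trans hc.le
  · intro i hi
    rw [hi, ncard_C] at h1
    omega

theorem isFlat_B : matroid.IsFlat B := by
  obtain ⟨J, hJ, hc, hI⟩ := exists_subset_B_sdiff_A
  refine isFlat_of_forall_insert (subset_ground _) (hJ.trans Set.sdiff_subset) (hc ▸ rk_B_le)
    fun e _ he => ?_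
  rw [indep_iff]
  exact indep_insert_of_subset_B_sdiff_A hJ hc.le (Or.inr he)

theorem isFlat_C (i : Fin 7) : matroid.IsFlat (C i) := by
  obtain ⟨J, hJ, hc, hI⟩ := exists_subset_C i
  refine isFlat_of_forall_insert (subset_ground _) hJ (hc ▸ rk_C_le i) fun e _ he => ?_
  rw [indep_iff]
  have h0 := ncard_inter_B_eq_zero hJ
  have h1 := ncard_insert_inter_le e J B
  have h2 := ncard_inter_A_le (insert e J)
  refine ⟨⟨by omega, by omega, (Set.ncard_insert_le e J).trans (by omega)⟩, fun j hj => ?_⟩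
  obtain ⟨x, hx⟩ : J.Nonempty := Set.nonempty_of_ncard_ne_zero (by omega)
  obtain rfl := eq_of_mem_C (hJ hx) (hj ▸ Set.mem_insert_of_mem e hx)
  exact he (hj ▸ Set.mem_insert e J)

/-- The connected flats of the example. -/
abbrev family : Set (Flat matroid) := flagFamily matroid A B C

theorem mem_family_of_C_subset {F : Flat matroid} {i : Fin 7} (h : C i ⊆ F) : F ∈ family := by
  by_cases hr : rk matroid (F : Set Ground) ≤ 9
  · have h1 : (⟨C i, isFlat_C i⟩ : Flat matroid) = F :=
      eq_of_le_of_rk_le h (hr.trans (rk_C i).ge)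
    exact Or.inr (Or.inr (Or.inr (Or.inl ⟨i, congrArg Subtype.val h1.symm⟩)))
  · have h1 : F = ⟨matroid.E, matroid.ground_isFlat⟩ :=
      eq_of_le_of_rk_le F.2.subset_ground (rk_ground_le.trans (by omega))
    exact Or.inr (Or.inr (Or.inl (congrArg Subtype.val h1)))

theorem ncard_inter_A_le_three {F : Flat matroid} (h : ¬ A ⊆ F) :
    ((F : Set Ground) ∩ A).ncard ≤ 3 := by
  by_contra! h4
  obtain ⟨J, hJ, hc⟩ := Set.exists_subset_card_eq h4
  exact h (subset_flat_of_rk_le (subset_ground _) (indep_iff.2 (indep_of_ncard_le_four hc.le))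
    (hJ.trans Set.inter_subset_right) (rk_A_le.trans hc.ge) (hJ.trans Set.inter_subset_left))

theorem ncard_inter_B_le_six {F : Flat matroid} (h : ¬ B ⊆ F) {I : Set Ground} (hIF : I ⊆ F)
    (hI : (I ∩ A).ncard ≤ 4) : (I ∩ B).ncard ≤ 6 := by
  by_contra! h7
  obtain ⟨J, hJ, hc⟩ := Set.exists_subset_card_eq h7
  have hJI := hJ.trans Set.inter_subset_left
  refine h (subset_flat_of_rk_le (J := J) (subset_ground _) (indep_iff.2 ⟨⟨?_, ?_, ?_⟩, ?_⟩)
    (hJ.trans Set.inter_subset_right) (rk_B_le.trans hc.ge) (hJI.trans hIF))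
  · exact (Set.ncard_le_ncard (Set.inter_subset_inter_left _ hJI)).trans hI
  · exact (Set.ncard_le_ncard Set.inter_subset_left).trans hc.le
  · omega
  · rintro i rfl
    rw [ncard_C] at hc
    omega

/-- Ten elements of `F` meeting the bounds on `A` and `B` would be a basis, forcing `F` to be the
ground set, or some `C i`, forcing `F` into the family. So only those two bounds matter inside `F`.
-/
theorem indep_of_subset_flat {F : Flat matroid} (h : F ∉ family) {I : Set Ground} (hIF : I ⊆ F)
    (hA : (I ∩ A).ncard ≤ 4) (hB : (I ∩ B).ncard ≤ 7) : Indep I := by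
  have h9 : I.ncard ≤ 9 := by
    by_contra! h10
    obtain ⟨J, hJ, hc⟩ := Set.exists_subset_card_eq h10
    by_cases hJC : ∃ i, J = C i
    · obtain ⟨i, rfl⟩ := hJC
      exact h (mem_family_of_C_subset (hJ.trans hIF))
    · push Not at hJC
      have hJI : Indep J :=
        ⟨⟨(Set.ncard_le_ncard (Set.inter_subset_inter_left _ hJ)).trans hA,
          (Set.ncard_le_ncard (Set.inter_subset_inter_left _ hJ)).trans hB, hc.le⟩, hJC⟩
      exact h (Or.inr (Or.inr (Or.inl (F.2.subset_ground.antisymm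
        (subset_flat_of_rk_le subset_rfl (indep_iff.2 hJI) (subset_ground _)
          (rk_ground_le.trans hc.ge) (hJ.trans hIF))))))
  refine ⟨⟨hA, hB, by omega⟩, ?_⟩
  rintro i rfl
  rw [ncard_C] at h9
  omega

theorem subset_closure_inter {I : Set Ground} (hI : Indep I) {X J : Set Ground} (hJX : J ⊆ X)
    (hJI : J ⊆ I) (h : rk matroid X ≤ J.ncard) : X ⊆ matroid.closure (I ∩ X) :=
  (subset_closure_of_rk_le (subset_ground _) ((indep_iff.2 hI).subset hJI) hJX h).trans
    (matroid.closure_subset_closure (Set.subset_inter hJI hJX))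

/-- Outside the largest of `B`, `A` contained in `F`, all of `F` is kept; inside it a basis is
chosen. If `F` contains neither, `F` is itself independent. A basis of `B` is taken in `B \ A` so
that the constraint on `A` is vacuous. -/
theorem exists_indep_spanning_factors {F : Flat matroid} (hF : F ∉ family) :
    ∃ I, matroid.Indep I ∧ I ⊆ F ∧
      ∀ G ∈ factors family F, (G : Set Ground) ⊆ matroid.closure (I ∩ G) := by
  let FA : Flat matroid := ⟨A, isFlat_A⟩
  let FB : Flat matroid := ⟨B, isFlat_B⟩
  have hFA : FA ∈ family := Or.inl rfl
  have hFB : FB ∈ family := Or.inr (Or.inl rfl)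
  have hnA : ∀ e, ¬ A ⊆ {e} := fun e h => by
    have := Set.ncard_le_ncard h
    rw [ncard_A, Set.ncard_singleton] at this
    omega
  -- A point dropped from `I` lies in a copy of `A` or `B` inside `F`, so its singleton is not a
  -- factor and need not be spanned; likewise `A` is not a factor once `B ⊆ F`.
  have key : ∀ I : Set Ground, Indep I → (A ⊆ F → ¬ B ⊆ F → A ⊆ matroid.closure (I ∩ A)) →
      (B ⊆ F → B ⊆ matroid.closure (I ∩ B)) →
      (∀ e ∈ (F : Set Ground), e ∉ I → (e ∈ A ∧ A ⊆ F) ∨ (e ∈ B ∧ B ⊆ F)) →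
      ∀ G ∈ factors family F, (G : Set Ground) ⊆ matroid.closure (I ∩ G) := by
    intro I hI hA hB hs G hG
    have hGF : (G : Set Ground) ⊆ F := hG.1.2
    rcases hG.1.1 with h | h | h | ⟨i, h⟩ | ⟨e, h⟩
    · rw [h] at hGF ⊢
      refine hA hGF fun hBF => ?_
      have h1 : B ⊆ (G : Set Ground) := hG.2 ⟨hFB, hBF⟩ (h.subset.trans A_subset_B)
      have h2 := Set.ncard_le_ncard h1
      rw [h, ncard_A, ncard_B] at h2
      omega
    · rw [h] at hGF ⊢
      exact hB hGF
    · exact absurd (Or.inr (Or.inr (Or.inl (F.2.subset_ground.antisymm (h ▸ hGF))))) hF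
    · exact absurd (mem_family_of_C_subset (h ▸ hGF)) hF
    · have heF : e ∈ (F : Set Ground) := hGF (h ▸ rfl)
      by_cases heI : e ∈ I
      · rw [h, Set.inter_eq_right.2 (Set.singleton_subset_iff.2 heI)]
        exact matroid.subset_closure _ (subset_ground _)
      · rcases hs e heF heI with ⟨he, hAF⟩ | ⟨he, hBF⟩
        · have h1 : A ⊆ (G : Set Ground) :=
            hG.2 ⟨hFA, hAF⟩ (h.subset.trans (Set.singleton_subset_iff.2 he))
          exact absurd (h ▸ h1) (hnA e)
        · have h1 : B ⊆ (G : Set Ground) :=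
            hG.2 ⟨hFB, hBF⟩ (h.subset.trans (Set.singleton_subset_iff.2 he))
          exact absurd (h ▸ A_subset_B.trans h1) (hnA e)
  by_cases hB : B ⊆ F
  · obtain ⟨J, hJ, hc, -⟩ := exists_subset_B_sdiff_A
    have hJB := hJ.trans Set.sdiff_subset
    have hIF : J ∪ ((F : Set Ground) \ B) ⊆ F :=
      Set.union_subset (hJB.trans hB) Set.sdiff_subset
    have hIB : (J ∪ ((F : Set Ground) \ B)) ∩ B = J := by
      rw [Set.union_inter_distrib_right, Set.sdiff_inter_self, Set.union_empty,
        Set.inter_eq_left.2 hJB]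
    have hIA : (J ∪ ((F : Set Ground) \ B)) ∩ A ⊆ J ∩ A := fun x hx =>
      ⟨hIB.subset ⟨hx.1, A_subset_B hx.2⟩, hx.2⟩
    have hI : Indep (J ∪ ((F : Set Ground) \ B)) := by
      refine indep_of_subset_flat hF hIF ((Set.ncard_le_ncard hIA).trans ?_) ?_
      · rw [ncard_inter_A_eq_zero hJ]
        norm_num
      · rw [hIB, hc]
    refine ⟨_, indep_iff.2 hI, hIF, key _ hI (fun _ h => absurd hB h) (fun _ => ?_) ?_⟩
    · exact subset_closure_inter hI hJB Set.subset_union_left (rk_B_le.trans hc.ge)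
    · exact fun e he heI => Or.inr ⟨by_contra fun h => heI (Or.inr ⟨he, h⟩), hB⟩
  by_cases hA : A ⊆ F
  · obtain ⟨J, hJ, hc, -⟩ := exists_subset_A
    have hIF : J ∪ ((F : Set Ground) \ A) ⊆ F :=
      Set.union_subset (hJ.trans hA) Set.sdiff_subset
    have hIA : ((J ∪ ((F : Set Ground) \ A)) ∩ A).ncard ≤ 4 := by
      rw [Set.union_inter_distrib_right, Set.sdiff_inter_self, Set.union_empty,
        Set.inter_eq_left.2 hJ, hc]
    have hI : Indep (J ∪ ((F : Set Ground) \ A)) :=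
      indep_of_subset_flat hF hIF hIA ((ncard_inter_B_le_six hB hIF hIA).trans (by norm_num))
    refine ⟨_, indep_iff.2 hI, hIF, key _ hI (fun _ _ => ?_) (fun h => absurd h hB) ?_⟩
    · exact subset_closure_inter hI hJ Set.subset_union_left (rk_A_le.trans hc.ge)
    · exact fun e he heI => Or.inl ⟨by_contra fun h => heI (Or.inr ⟨he, h⟩), hA⟩
  · have hIA : ((F : Set Ground) ∩ A).ncard ≤ 4 := (ncard_inter_A_le_three hA).trans (by norm_num)
    have hI : Indep F := indep_of_subset_flat hF subset_rfl hIA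
      ((ncard_inter_B_le_six hB subset_rfl hIA).trans (by norm_num))
    exact ⟨F, indep_iff.2 hI, subset_rfl, key _ hI (fun h => absurd h hA) (fun h => absurd h hB)
      fun e he heI => absurd he heI⟩

theorem isBuildingSet_family : IsBuildingSet family :=
  isBuildingSet_flagFamily (Set.nonempty_of_ncard_ne_zero (by rw [ncard_A]; norm_num)) A_subset_B
    ⟨Sum.inl 0, Set.mem_univ _⟩
    (fun i => Set.nonempty_of_ncard_ne_zero (by rw [ncard_C]; norm_num))
    (fun e _ => isFlat_singleton e) (fun _ _ h => mem_family_of_C_subset h)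
    (fun _ h => exists_indep_spanning_factors h)

/-- The sizes 5, 8, 10 of `A`, `B \ A`, `C i` are the least that leave, after removal of two points,
an independent set of 3, 6, 8 elements, one less than the ranks 4, 7, 9. Singletons have no two
distinct points. -/
theorem isConnected_of_mem_family {G : Flat matroid} (hG : G ∈ family) :
    IsConnected (matroid.restrict (G : Set Ground)) := by
  refine isConnected_restrict fun e he f hf hef => ?_
  simp only [indep_iff]
  rcases hG with h | h | h | ⟨i, h⟩ | ⟨x, h⟩ <;> rw [h] at he hf ⊢
  · obtain ⟨J, hJ, heJ, hfJ, hc⟩ := exists_subset_avoiding (X := A) (n := 3)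
      (by rw [ncard_A]) e f
    have hins : ∀ x, Indep (insert x J) := fun x =>
      indep_of_ncard_le_four ((Set.ncard_insert_le x J).trans (by omega))
    exact ⟨J, hJ, heJ, hfJ, hins e, hins f, by rw [hc]; exact rk_A_le⟩
  · obtain ⟨J, hJ, heJ, hfJ, hc⟩ := exists_subset_avoiding (X := B \ A) (n := 6)
      (by rw [ncard_B_sdiff_A]) e f
    have hins : ∀ x, Indep (insert x J) := fun x =>
      indep_insert_of_subset_B_sdiff_A hJ (by omega) (Or.inl hc.le)
    exact ⟨J, hJ.trans Set.sdiff_subset, heJ, hfJ, hins e, hins f, by rw [hc]; exact rk_B_le⟩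
  · obtain ⟨J, heJ, hfJ, hc, hins⟩ := exists_avoiding e f
    exact ⟨J, subset_ground J, heJ, hfJ, hins e, hins f, by rw [hc]; exact rk_ground_le⟩
  · obtain ⟨J, hJ, heJ, hfJ, hc⟩ := exists_subset_avoiding (X := C i) (n := 8)
      (by rw [ncard_C]) e f
    have hins : ∀ x ∈ C i, Indep (insert x J) := fun x hx =>
      indep_of_subset_C (Set.insert_subset hx hJ) ((Set.ncard_insert_le x J).trans (by omega))
    exact ⟨J, hJ, heJ, hfJ, hins e he, hins f hf, by rw [hc]; exact rk_C_le i⟩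
  · exact absurd ((show e = x from he).trans (show f = x from hf).symm) hef

theorem minBuildingSet_matroid : minBuildingSet matroid = family :=
  minBuildingSet_eq isBuildingSet_family fun _ h => isConnected_of_mem_family h

theorem not_hasLogConcaveCoeffs_family : ¬ HasLogConcaveCoeffs (chowPolynomial family) := by
  refine not_hasLogConcaveCoeffs_flagFamily isFlat_A isFlat_B isFlat_C A_subset_B ?_ ?_
    rk_A.ge (by rw [rk_A, rk_B]) (by rw [rk_B, rk_ground]) (fun i => by rw [rk_C, rk_ground])
  · intro i h
    obtain ⟨x, hx⟩ : A.Nonempty := Set.nonempty_of_ncard_ne_zero (by rw [ncard_A]; norm_num)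
    exact Set.disjoint_left.1 (disjoint_B_C i) (A_subset_B hx) (h hx)
  · intro i j h
    exact eq_of_mem_C (x := Sum.inr (i, 0)) ⟨0, rfl⟩ (h ▸ ⟨0, rfl⟩)

end Example

end ChowPoly

theorem theorem1p6 :
    (∃ (α : Type) (M : Matroid α), M.Finite ∧ M.Loopless ∧
      ChowPoly.IsBuildingSet (ChowPoly.minBuildingSet M) ∧
      ¬ ChowPoly.HasLogConcaveCoeffs (ChowPoly.chowPolynomial (ChowPoly.minBuildingSet M))) ∧
    (∃ N : ℕ, ∀ n : ℕ, N ≤ n →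
      ∃ 𝒢 : Set (ChowPoly.Flat (ChowPoly.boolean n)),
        ChowPoly.IsBuildingSet 𝒢 ∧
        ¬ ChowPoly.HasLogConcaveCoeffs (ChowPoly.chowPolynomial 𝒢)) := by
  refine ⟨⟨_, ChowPoly.Example.matroid, inferInstance, inferInstance, ?_⟩,
    13, fun n hn => ChowPoly.exists_boolean hn⟩
  rw [ChowPoly.Example.minBuildingSet_matroid]
  exact ⟨ChowPoly.Example.isBuildingSet_family, ChowPoly.Example.not_hasLogConcaveCoeffs_family⟩
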